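/- Let $r,\sigma,\rho,\beta,m,T>0$, $\delta\ge 0$ and $\mu\in\mathbb R$ satisfy $$\frac{\mu}{\sigma^2}>\beta m,\qquad \rho\le\frac{\mu^2}{2\sigma^2m}+\frac12\beta^2\sigma^2m-\beta\mu ,$$ and let $W$ be a standard one-dimensional Brownian motion relative to a filtration $(\mathcal F_s)$. For $(t,x)\in\mathcal N_T:=[0,T]\times\mathbb R$, a stopping time $\tau\in[t,T]$ and an adapted control $f$, let $X=X^{\tau,f}$ be the surplus process $$dX_s=\bigl(rX_s+\mu f_s-\delta-\rho\mathbf 1_{\{s\ge\tau\}}\bigr)ds+\sigma f_s\,dW_s,\quad s\in[t,T],\qquad X_t=x .$$ Let $U(t,x)=-\frac1m e^{-mx}$. The pair $(\tau,f)$ is admissible at $(t,x)$ if $\int_0^T f_s^4\,ds<\infty$ a.s., $f_s\in[0,\beta]$ for $t\le s<\tau$, $f_s\in[0,\infty)$ for $\tau\le s\le T$, and $\mathbb E[U^-(T,X_T^{\tau,f})]<\infty$, where $U^-=\max\{0,-U\}$. Write $$\mathcal L^f=\tfrac12\sigma^2f^2\partial_{xx}+(rx+\mu f-\delta)\partial_x,\qquad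 \mathcal L_1^f=\tfrac12\sigma^2f^2\partial_{xx}+(rx+\mu f-\delta-\rho)\partial_x .$$ Put $d(t)=-\frac{(\delta+\rho)m}{r}(1-e^{-r(T-t)})$, $g(t)=-\frac{\mu^2}{2\sigma^2}(T-t)$, $f^1_t=\frac{\mu}{\sigma^2m}e^{-r(T-t)}$, $$h(t)=\frac{\mu^2}{2\sigma^2m}+\frac12\beta^2\sigma^2m\,e^{2r(T-t)}-(\beta\mu+\rho)e^{r(T-t)},$$ $t_1=\inf\{t\in[0,T]:f^1_t\ge\beta\}$, $t_2=\inf\{t\in[t_1,T]:h(t)\ge0\}$, $$d_0(t)=\Bigl(\tfrac{(\delta+\rho)m}{r}-\tfrac{\rho m}{r}e^{r(T-t_1)}\Bigr)e^{-r(T-t)}-\tfrac{\delta m}{r},\qquad g_0(t)=-\tfrac{\mu^2}{2\sigma^2}(T-t)+\int_{t_1}^{t_2}mh(s)\,ds,$$ $$V^{(1)}(t,x)=-\tfrac1m\exp\{(-mx-d(t))e^{r(T-t)}+g(t)\},$$ $$V(t,x)=\begin{cases}-\frac1m\exp\{(-mx-d_0(t))e^{r(T-t)}+g_0(t)\},&0\le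 t<t_1,\\-\frac1m\exp\{\int_t^{t_2}mh(s)ds+(-mx-d(t))e^{r(T-t)}+g(t)\},&t_1\le t<t_2,\\V^{(1)}(t,x),&t_2\le t\le T,\end{cases}$$ and $f^*_t=\beta$ for $t\in[t_1,t_2)$, $f^*_t=f^1_t$ for $t\in[0,t_1)\cup[t_2,T]$. For initial time $t$ put $\bar\tau=\max\{t,t_2\}$. Then $V$, $V^{(1)}$, $\bar\tau$ and $f^*$ satisfy the hypotheses of the verification theorem: 0. $V^{(1)}$ is a strong (a.e.) solution of $-\partial_tV^{(1)}-\max_{f\ge0}\mathcal L_1^fV^{(1)}=0$ in $\mathcal N_T$, $V^{(1)}(T,\cdot)=U(T,\cdot)$; and $V\ge V^{(1)}$ is a strong solution of the variational inequality $-\partial_tV-\max_{f\in[0,\beta]}\mathcal L^fV=0$ where $V>V^{(1)}$, $\ge0$ where $V=V^{(1)}$, $V(T,\cdot)=U(T,\cdot)$. 1. $V,V^{(1)}\in W^{2,1}_{p,\mathrm{loc}}(\mathcal N_T)\cap C(\mathcal N_T)$ for some $p>2$; moreover the derivatives $\partial_t,\partial_x,\partial_{xx}$ of both functions exist pointwise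 on $\mathcal N_T$ (one-sided in $t$ at $t=0,T$) and are their weak derivatives. 2. $\partial_xV>0$ and $\partial_{xx}V<0$ a.e. in $\mathcal N_T$. 3. For all $(t,x)\in\mathcal N_T$, with $X=X^{\bar\tau,f^*}$ started from $X_t=x$, $\mathbb E\int_t^T(\partial_xV(s,X_s))^4ds<\infty$ and $\mathbb E\int_t^T(\partial_xV^{(1)}(s,X_s))^4ds<\infty$. 4. For all $(t,x)\in\mathcal N_T$: the equation of $X^{\bar\tau,f^*}$ has a unique strong solution; $\bar\tau$ is the a.s. unique stopping time $\tau\in[t,T]$ with $\tau=\inf\{s\in[t,T]:V(s,X^{\tau,f^*}_s)=V^{(1)}(s,X^{\tau,f^*}_s)\}$ a.s.; $(\bar\tau,f^*)$ is admissible at $(t,x)$; and, at every point of $\mathcal N_T$, $-\partial_tV-\mathcal L^{f^*}V=-\partial_tV-\max_{f\in[0,\beta]}\mathcal L^fV=0$ where $V>V^{(1)}$, and $-\partial_tV^{(1)}-\mathcal L_1^{f^*}V^{(1)}=-\partial_tV^{(1)}-\max_{f\ge0}\mathcal L_1^fV^{(1)}=0$ where $V=V^{(1)}$. In particular the explicit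 control $f^*$, together with $\bar\tau$, is admissible for every initial datum $(t,x)$. -/

import Mathlib

open MeasureTheory ProbabilityTheory Filter Set
open scoped ENNReal NNReal Topology

/-! ## Itô integral and Brownian motion -/

/-- `W` is a standard one-dimensional Brownian motion relative to the filtration `ℱ`. -/
structure IsFilteredBrownian {Ω : Type*} {mΩ : MeasurableSpace Ω} (ℱ : Filtration ℝ≥0 mΩ)
    (P : Measure Ω) (W : ℝ≥0 → Ω → ℝ) : Prop where
  isBrownian : IsBrownianReal W P
  adapted : Adapted ℱ W
  indep : ∀ s u : ℝ≥0, s ≤ u →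
    Indep (MeasurableSpace.comap (fun ω => W u ω - W s ω) inferInstance) (ℱ s) P

/-- A bounded elementary process on `[t, T]`: a finite sum
`∑ i < n, coef i · 1_{(grid i, grid (i+1)]}` with `coef i` known at time `grid i`. -/
structure ElementaryProcess {Ω : Type*} {mΩ : MeasurableSpace Ω} (ℱ : Filtration ℝ≥0 mΩ)
    (t T : ℝ) where
  n : ℕ
  grid : ℕ → ℝ
  coef : ℕ → Ω → ℝ
  grid_mono : Monotone grid
  grid_mem : ∀ i, grid i ∈ Icc t T
  coef_meas : ∀ i, Measurable[ℱ (grid i).toNNReal] (coef i)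
  coef_bdd : ∃ C : ℝ, ∀ i ω, |coef i ω| ≤ C

namespace ElementaryProcess

variable {Ω : Type*} {mΩ : MeasurableSpace Ω} {ℱ : Filtration ℝ≥0 mΩ} {t T : ℝ}

/-- The value of an elementary process at time `s`. -/
noncomputable def value (φ : ElementaryProcess ℱ t T) (s : ℝ) (ω : Ω) : ℝ :=
  ∑ i ∈ Finset.range φ.n, (Ioc (φ.grid i) (φ.grid (i + 1))).indicator (fun _ => φ.coef i ω) s

/-- The stochastic integral of an elementary process over `[t, s]`. -/
noncomputable def integral (φ : ElementaryProcess ℱ t T) (W : ℝ≥0 → Ω → ℝ) (s : ℝ) (ω : Ω) : ℝ :=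
  ∑ i ∈ Finset.range φ.n, φ.coef i ω *
    (W (min (φ.grid (i + 1)) s).toNNReal ω - W (min (φ.grid i) s).toNNReal ω)

end ElementaryProcess

/-- `I` is (a version of) the Itô integral process `I_s = ∫_t^s f dW`, `s ∈ [t, T]`:
a continuous adapted process that is the limit in probability of the integrals of elementary
processes `φ k` with `∫_t^T (φ k - f)² ds → 0` in probability. -/
structure IsItoIntegral {Ω : Type*} {mΩ : MeasurableSpace Ω} (ℱ : Filtration ℝ≥0 mΩ)
    (P : Measure Ω) (W : ℝ≥0 → Ω → ℝ) (t T : ℝ) (f I : ℝ → Ω → ℝ) : Prop where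
  integrand_measurable : Measurable (Function.uncurry f)
  integrand_adapted : ∀ s ∈ Icc t T, Measurable[ℱ s.toNNReal] (f s)
  adapted : ∀ s ∈ Icc t T, Measurable[ℱ s.toNNReal] (I s)
  continuous : ∀ᵐ ω ∂P, ContinuousOn (fun s => I s ω) (Icc t T)
  approx : ∃ φ : ℕ → ElementaryProcess ℱ t T,
    (∀ ε : ℝ≥0∞, 0 < ε → Tendsto (fun k =>
      P {ω | ε ≤ ∫⁻ s in Icc t T, ENNReal.ofReal (((φ k).value s ω - f s ω) ^ 2)}) atTop (𝓝 0)) ∧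
    ∀ s ∈ Icc t T, TendstoInMeasure P (fun k ω => (φ k).integral W s ω) atTop (I s)

/-! ## The controlled investment model -/

/-- The parameters of the model: interest rate `r`, excess return `μ`, volatility `σ`,
liability rate `δ`, opportunity cost rate `ρ`, initial trading limit `β`, risk aversion `m`
and horizon `T`. -/
structure InvestmentModel where
  r : ℝ
  μ : ℝ
  σ : ℝ
  δ : ℝ
  ρ : ℝ
  β : ℝ
  m : ℝ
  T : ℝ

namespace InvestmentModel

/-- `X` solves, on `[t, T]` with `X_t = x`, the surplus equation
`dX_s = (r X_s + μ f_s - δ - ρ 1_{s ≥ τ}) ds + σ f_s dW_s`. -/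
structure IsSurplus (M : InvestmentModel) {Ω : Type*} {mΩ : MeasurableSpace Ω}
    (ℱ : Filtration ℝ≥0 mΩ) (P : Measure Ω) (W : ℝ≥0 → Ω → ℝ) (t x : ℝ) (τ : Ω → ℝ)
    (f X : ℝ → Ω → ℝ) : Prop where
  adapted : ∀ s ∈ Icc t M.T, Measurable[ℱ s.toNNReal] (X s)
  continuous : ∀ᵐ ω ∂P, ContinuousOn (fun s => X s ω) (Icc t M.T)
  control_integrable : ∀ᵐ ω ∂P, IntervalIntegrable (fun s => f s ω) volume t M.T
  equation : ∃ I : ℝ → Ω → ℝ, IsItoIntegral ℱ P W t M.T f I ∧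
    ∀ᵐ ω ∂P, ∀ s ∈ Icc t M.T, X s ω = x
      + (∫ u in t..s, (M.r * X u ω + M.μ * f u ω - M.δ - (Ici (τ ω)).indicator (fun _ => M.ρ) u))
      + M.σ * I s ω

/-- The stopping times with values in `[t, T]`. -/
def StoppingTimes (M : InvestmentModel) {Ω : Type*} {mΩ : MeasurableSpace Ω}
    (ℱ : Filtration ℝ≥0 mΩ) (t : ℝ) : Set (Ω → ℝ) :=
  {τ | IsStoppingTime ℱ (fun ω => ((τ ω).toNNReal : WithTop ℝ≥0)) ∧ ∀ ω, τ ω ∈ Icc t M.T}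

/-- The pair `(τ, f)` is admissible at `(t, x)` for the terminal utility `U(T, ·)`. -/
structure Admissible (M : InvestmentModel) {Ω : Type*} {mΩ : MeasurableSpace Ω}
    (ℱ : Filtration ℝ≥0 mΩ) (P : Measure Ω) (W : ℝ≥0 → Ω → ℝ) (U : ℝ → ℝ → ℝ) (t x : ℝ)
    (τ : Ω → ℝ) (f : ℝ → Ω → ℝ) : Prop where
  stopping : τ ∈ M.StoppingTimes ℱ t
  measurable : Measurable (Function.uncurry f)
  adapted : ∀ s ∈ Icc t M.T, Measurable[ℱ s.toNNReal] (f s)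
  integrable : ∀ᵐ ω ∂P, ∫⁻ s in Icc 0 M.T, ENNReal.ofReal (f s ω ^ 4) < ⊤
  before : ∀ ω, ∀ s ∈ Icc t M.T, s < τ ω → f s ω ∈ Icc 0 M.β
  after : ∀ ω, ∀ s ∈ Icc t M.T, τ ω ≤ s → f s ω ∈ Ici 0
  utility : ∃ X : ℝ → Ω → ℝ, M.IsSurplus ℱ P W t x τ f X ∧
    ∫⁻ ω, ENNReal.ofReal (max 0 (-U M.T (X M.T ω))) ∂P < ⊤

/-! ## Derivatives, Sobolev space, HJB equation and variational inequality -/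

/-- `∂ₜ v (t, x)`, one-sided at the ends of `[0, T]`. -/
noncomputable def dt (M : InvestmentModel) (v : ℝ → ℝ → ℝ) (t x : ℝ) : ℝ :=
  derivWithin (fun s => v s x) (Icc 0 M.T) t

/-- `∂ₓ v (t, x)`. -/
noncomputable def dx (v : ℝ → ℝ → ℝ) (t x : ℝ) : ℝ := deriv (v t) x

/-- `∂ₓₓ v (t, x)`. -/
noncomputable def dxx (v : ℝ → ℝ → ℝ) (t x : ℝ) : ℝ := deriv (deriv (v t)) x

/-- `vt`, `vx`, `vxx` are the weak partial derivatives of `v` in `(0, T) × ℝ`. -/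
def HasWeakPartials (M : InvestmentModel) (v vt vx vxx : ℝ → ℝ → ℝ) : Prop :=
  ∀ φ : ℝ × ℝ → ℝ, ContDiff ℝ (⊤ : ℕ∞) φ → HasCompactSupport φ →
    tsupport φ ⊆ Ioo 0 M.T ×ˢ univ →
    (∫ z, v z.1 z.2 * fderiv ℝ φ z (1, 0) = -∫ z, vt z.1 z.2 * φ z) ∧
    (∫ z, v z.1 z.2 * fderiv ℝ φ z (0, 1) = -∫ z, vx z.1 z.2 * φ z) ∧
    (∫ z, v z.1 z.2 * fderiv ℝ (fun w => fderiv ℝ φ w (0, 1)) z (0, 1)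
      = ∫ z, vxx z.1 z.2 * φ z)

/-- `u ∈ L^p(K)` for every compact `K ⊆ [0, T] × ℝ`. -/
def MemLpLoc (M : InvestmentModel) (p : ℝ) (u : ℝ → ℝ → ℝ) : Prop :=
  ∀ R : ℝ, MemLp (Function.uncurry u) (ENNReal.ofReal p)
    (volume.restrict (Icc 0 M.T ×ˢ Icc (-R) R))

/-- `v ∈ W^{2,1}_{p,loc}([0, T] × ℝ)`. -/
def MemW21Loc (M : InvestmentModel) (p : ℝ) (v : ℝ → ℝ → ℝ) : Prop :=
  ∃ vt vx vxx : ℝ → ℝ → ℝ, M.HasWeakPartials v vt vx vxx ∧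
    M.MemLpLoc p v ∧ M.MemLpLoc p vt ∧ M.MemLpLoc p vx ∧ M.MemLpLoc p vxx

/-- The pointwise partial derivatives of `v` entering the equations exist on `[0, T] × ℝ`, and they
are its weak derivatives; so the symbols `dt`, `dx`, `dxx` denote both. -/
structure HasPartials (M : InvestmentModel) (v : ℝ → ℝ → ℝ) : Prop where
  time : ∀ t ∈ Icc 0 M.T, ∀ x, DifferentiableWithinAt ℝ (fun s => v s x) (Icc 0 M.T) t
  space : ∀ t ∈ Icc 0 M.T, ∀ x, DifferentiableAt ℝ (v t) x
  space_space : ∀ t ∈ Icc 0 M.T, ∀ x, DifferentiableAt ℝ (deriv (v t)) x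
  weak : M.HasWeakPartials v (M.dt v) (dx v) (dxx v)

/-- `𝓛^f v (t, x) = ½ σ² f² ∂ₓₓ v + (r x + μ f - δ) ∂ₓ v`. -/
noncomputable def genBefore (M : InvestmentModel) (v : ℝ → ℝ → ℝ) (t x f : ℝ) : ℝ :=
  1 / 2 * M.σ ^ 2 * f ^ 2 * dxx v t x + (M.r * x + M.μ * f - M.δ) * dx v t x

/-- `𝓛₁^f v (t, x) = ½ σ² f² ∂ₓₓ v + (r x + μ f - δ - ρ) ∂ₓ v`. -/
noncomputable def genAfter (M : InvestmentModel) (v : ℝ → ℝ → ℝ) (t x f : ℝ) : ℝ :=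
  1 / 2 * M.σ ^ 2 * f ^ 2 * dxx v t x + (M.r * x + M.μ * f - M.δ - M.ρ) * dx v t x

/-- `v1` solves, almost everywhere in `[0, T] × ℝ`,
`-∂ₜ v1 - max_{f ≥ 0} 𝓛₁^f v1 = 0`, with `v1(T, ·) = U(T, ·)`. -/
structure SolvesHJB (M : InvestmentModel) (U v1 : ℝ → ℝ → ℝ) : Prop where
  equation : ∀ᵐ z : ℝ × ℝ ∂(volume.restrict (Icc 0 M.T ×ˢ univ)),
    ∃ A, IsGreatest (M.genAfter v1 z.1 z.2 '' Ici 0) A ∧ -M.dt v1 z.1 z.2 - A = 0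
  terminal : ∀ x, v1 M.T x = U M.T x

/-- `v` solves, almost everywhere in `[0, T] × ℝ`, the variational inequality with obstacle `v1`:
`v ≥ v1`, `-∂ₜ v - max_{f ∈ [0, β]} 𝓛^f v` vanishes where `v > v1` and is nonnegative where
`v = v1`, and `v(T, ·) = U(T, ·)`. -/
structure SolvesVI (M : InvestmentModel) (U v1 v : ℝ → ℝ → ℝ) : Prop where
  obstacle : ∀ t ∈ Icc 0 M.T, ∀ x, v1 t x ≤ v t x
  equation : ∀ᵐ z : ℝ × ℝ ∂(volume.restrict (Icc 0 M.T ×ˢ univ)),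
    ∃ A, IsGreatest (M.genBefore v z.1 z.2 '' Icc 0 M.β) A ∧
      (v1 z.1 z.2 < v z.1 z.2 → -M.dt v z.1 z.2 - A = 0) ∧
      (v z.1 z.2 = v1 z.1 z.2 → 0 ≤ -M.dt v z.1 z.2 - A)
  terminal : ∀ x, v M.T x = U M.T x

/-- `τ = inf {s ≥ t : v(s, X_s) = v1(s, X_s)}` almost surely. -/
def IsContactTime (M : InvestmentModel) {Ω : Type*} {mΩ : MeasurableSpace Ω} (P : Measure Ω)
    (v v1 : ℝ → ℝ → ℝ) (t : ℝ) (X : ℝ → Ω → ℝ) (τ : Ω → ℝ) : Prop :=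
  ∀ᵐ ω ∂P, IsGLB {s | s ∈ Icc t M.T ∧ v s (X s ω) = v1 s (X s ω)} (τ ω)

/-- The hypotheses of the verification theorem, for the candidate value functions `v` (with the
option to expand) and `v1` (after expansion), the candidate stopping times `τ t x` for the initial
data `(t, x)`, and the candidate feedback control `F`, i.e. `f_s = F(s, X_s)`. -/
structure VerificationHypotheses (M : InvestmentModel) {Ω : Type*} {mΩ : MeasurableSpace Ω}
    (ℱ : Filtration ℝ≥0 mΩ) (P : Measure Ω) (W : ℝ≥0 → Ω → ℝ) (U v v1 : ℝ → ℝ → ℝ)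
    (τ : ℝ → ℝ → Ω → ℝ) (F : ℝ → ℝ → ℝ) : Prop where
  solves_HJB : M.SolvesHJB U v1
  solves_VI : M.SolvesVI U v1 v
  /- regularity -/
  sobolev : ∃ p : ℝ, 2 < p ∧ M.MemW21Loc p v ∧ M.MemW21Loc p v1
  continuous_v : ContinuousOn (Function.uncurry v) (Icc 0 M.T ×ˢ univ)
  continuous_v1 : ContinuousOn (Function.uncurry v1) (Icc 0 M.T ×ˢ univ)
  partials_v : M.HasPartials v
  partials_v1 : M.HasPartials v1
  /- monotonicity and concavity -/
  dx_pos : ∀ᵐ z : ℝ × ℝ ∂(volume.restrict (Icc 0 M.T ×ˢ univ)), 0 < dx v z.1 z.2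
  dxx_neg : ∀ᵐ z : ℝ × ℝ ∂(volume.restrict (Icc 0 M.T ×ˢ univ)), dxx v z.1 z.2 < 0
  /- the candidate state equation has a unique strong solution -/
  state_exists : ∀ t ∈ Icc 0 M.T, ∀ x, ∃ X : ℝ → Ω → ℝ,
    M.IsSurplus ℱ P W t x (τ t x) (fun s ω => F s (X s ω)) X
  state_unique : ∀ t ∈ Icc 0 M.T, ∀ x, ∀ X Y : ℝ → Ω → ℝ,
    M.IsSurplus ℱ P W t x (τ t x) (fun s ω => F s (X s ω)) X →
    M.IsSurplus ℱ P W t x (τ t x) (fun s ω => F s (Y s ω)) Y →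
    ∀ᵐ ω ∂P, ∀ s ∈ Icc t M.T, X s ω = Y s ω
  /- fourth moments of the space derivatives along the candidate state -/
  moment_v : ∀ t ∈ Icc 0 M.T, ∀ x, ∀ X : ℝ → Ω → ℝ,
    M.IsSurplus ℱ P W t x (τ t x) (fun s ω => F s (X s ω)) X →
    ∫⁻ ω, (∫⁻ s in Icc t M.T, ENNReal.ofReal (dx v s (X s ω) ^ 4)) ∂P < ⊤
  moment_v1 : ∀ t ∈ Icc 0 M.T, ∀ x, ∀ X : ℝ → Ω → ℝ,
    M.IsSurplus ℱ P W t x (τ t x) (fun s ω => F s (X s ω)) X →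
    ∫⁻ ω, (∫⁻ s in Icc t M.T, ENNReal.ofReal (dx v1 s (X s ω) ^ 4)) ∂P < ⊤
  /- `τ` is the unique solution of `τ = inf {s ≥ t : v(s, X_s) = v1(s, X_s)}`, where `X` is
  itself driven by `τ` -/
  contact : ∀ t ∈ Icc 0 M.T, ∀ x, τ t x ∈ M.StoppingTimes ℱ t ∧
    ∀ X : ℝ → Ω → ℝ, M.IsSurplus ℱ P W t x (τ t x) (fun s ω => F s (X s ω)) X →
      M.IsContactTime P v v1 t X (τ t x)
  contact_unique : ∀ t ∈ Icc 0 M.T, ∀ x, ∀ τ' ∈ M.StoppingTimes ℱ t, ∀ X : ℝ → Ω → ℝ,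
    M.IsSurplus ℱ P W t x τ' (fun s ω => F s (X s ω)) X → M.IsContactTime P v v1 t X τ' →
    τ' =ᵐ[P] τ t x
  /- the candidate control is admissible -/
  admissible : ∀ t ∈ Icc 0 M.T, ∀ x, ∀ X : ℝ → Ω → ℝ,
    M.IsSurplus ℱ P W t x (τ t x) (fun s ω => F s (X s ω)) X →
    M.Admissible ℱ P W U t x (τ t x) (fun s ω => F s (X s ω))
  /- the candidate control attains the maxima -/
  optimal_before : ∀ t ∈ Icc 0 M.T, ∀ x, v1 t x < v t x →
    IsGreatest (M.genBefore v t x '' Icc 0 M.β) (M.genBefore v t x (F t x)) ∧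
      -M.dt v t x - M.genBefore v t x (F t x) = 0
  optimal_after : ∀ t ∈ Icc 0 M.T, ∀ x, v t x = v1 t x →
    IsGreatest (M.genAfter v1 t x '' Ici 0) (M.genAfter v1 t x (F t x)) ∧
      -M.dt v1 t x - M.genAfter v1 t x (F t x) = 0

/-! ## The explicit solution under exponential utility -/

/-- The exponential utility. -/
noncomputable def expUtility (M : InvestmentModel) (_t x : ℝ) : ℝ :=
  -(1 / M.m) * Real.exp (-M.m * x)

noncomputable def d (M : InvestmentModel) (t : ℝ) : ℝ :=
  -((M.δ + M.ρ) * M.m / M.r) * (1 - Real.exp (-M.r * (M.T - t)))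

noncomputable def g (M : InvestmentModel) (t : ℝ) : ℝ :=
  -(M.μ ^ 2 / (2 * M.σ ^ 2)) * (M.T - t)

/-- `V⁽¹⁾`. -/
noncomputable def valueAfter (M : InvestmentModel) (t x : ℝ) : ℝ :=
  -(1 / M.m) * Real.exp ((-M.m * x - M.d t) * Real.exp (M.r * (M.T - t)) + M.g t)

/-- The unconstrained maximizer `f¹`. -/
noncomputable def freeControl (M : InvestmentModel) (t : ℝ) : ℝ :=
  M.μ / (M.σ ^ 2 * M.m) * Real.exp (-M.r * (M.T - t))

noncomputable def h (M : InvestmentModel) (t : ℝ) : ℝ :=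
  M.μ ^ 2 / (2 * M.σ ^ 2 * M.m) + 1 / 2 * M.β ^ 2 * M.σ ^ 2 * M.m * Real.exp (2 * M.r * (M.T - t))
    - (M.β * M.μ + M.ρ) * Real.exp (M.r * (M.T - t))

noncomputable def t1 (M : InvestmentModel) : ℝ := sInf {t ∈ Icc 0 M.T | M.β ≤ M.freeControl t}

noncomputable def t2 (M : InvestmentModel) : ℝ := sInf {t ∈ Icc M.t1 M.T | 0 ≤ M.h t}

noncomputable def d0 (M : InvestmentModel) (t : ℝ) : ℝ :=
  ((M.δ + M.ρ) * M.m / M.r - M.ρ * M.m / M.r * Real.exp (M.r * (M.T - M.t1)))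
    * Real.exp (-M.r * (M.T - t)) - M.δ * M.m / M.r

noncomputable def g0 (M : InvestmentModel) (t : ℝ) : ℝ :=
  -(M.μ ^ 2 / (2 * M.σ ^ 2)) * (M.T - t) + ∫ s in M.t1..M.t2, M.m * M.h s

/-- The explicit `V`. -/
noncomputable def value (M : InvestmentModel) (t x : ℝ) : ℝ :=
  if t < M.t1 then
    -(1 / M.m) * Real.exp ((-M.m * x - M.d0 t) * Real.exp (M.r * (M.T - t)) + M.g0 t)
  else if t < M.t2 then
    -(1 / M.m) * Real.exp ((∫ s in t..M.t2, M.m * M.h s)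
      + (-M.m * x - M.d t) * Real.exp (M.r * (M.T - t)) + M.g t)
  else M.valueAfter t x

/-- The explicit control `f*`. -/
noncomputable def optControl (M : InvestmentModel) (t : ℝ) : ℝ :=
  if t < M.t1 then M.freeControl t else if t < M.t2 then M.β else M.freeControl t

end InvestmentModel

/-! ## The Itô integral of elementary processes -/

section MartingaleTransform

/-! Analytic side. For a function -(1/m) e^{-m x e^{r(T-t)} + G(t)} the second space derivative is
-m e^{r(T-t)} times the first, so the generator is a positive weight times a concave quadratic in f
whose vertex f¹_t does not depend on x (`genBefore_value`, `genAfter_valueAfter`). Maximising means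
projecting f¹_t onto the allowed controls, and each equation becomes a scalar ODE for G.

Under the cap β the projection loses ½σ²m e^{2r(T-t)} max(0, f¹_t - β)², while not having expanded
saves ρ e^{r(T-t)}; `waitingCost` is the difference. If the exponent of V is that of V⁽¹⁾ plus ∫_t^T
m min(0, `waitingCost`), the residual of the variational inequality is the weight times max(0,
`waitingCost`) (`dt_sub_genBefore`). The integrand is continuous, so V is C¹ in time and nothing has
to be matched at t₁ or t₂. Everything then rests on a sign: `waitingCost` is negative before t₂ and
nonnegative after it, the latter because h(t) e^{-r(T-t)} is nondecreasing on [t₁, T] (`h_nonneg`).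
Hence V = V⁽¹⁾ exactly when t ≥ t₂, whatever x is. The contact set of every path is [max(t, t₂), T],
which settles the stopping time and its uniqueness.

Probabilistic side. The control f* is deterministic, nondecreasing and right continuous on [0, T].
Its Itô integral is built path by path through integration by parts
(`isItoIntegral_wienerIntegral`). That the integral does not depend on the approximating sequence
follows from a truncation estimate for martingale transforms (`measure_transform_ge_le`). The state
equation is then a linear integral equation driven by a continuous path; it has an explicit
solution, unique by Grönwall. The formula gives |X| ≤ C(1 + max |W|), and max |W| has exponential
moments by Doob's inequality on grids. Since the space derivatives of V and V⁽¹⁾ grow at most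
exponentially in |x|, the moment bounds and admissibility follow. -/

theorem memLp_two_bdd_mul {Ω : Type*} {mΩ : MeasurableSpace Ω} {P : Measure Ω} {c ξ : Ω → ℝ} (hc : Measurable c) (hcb : ∃ C, ∀ ω, |c ω| ≤ C)
    (hξ : MemLp ξ 2 P) : MemLp (fun ω => c ω * ξ ω) 2 P := by
  obtain ⟨C, hC⟩ := hcb
  refine MemLp.of_le_mul (c := C) hξ (hc.aestronglyMeasurable.mul hξ.1) (ae_of_all _ fun ω => ?_)
  rw [norm_mul]
  exact mul_le_mul_of_nonneg_right (hC ω) (norm_nonneg _)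

variable {Ω : Type*} {mΩ : MeasurableSpace Ω} {P : Measure Ω} [IsProbabilityMeasure P]
  {𝒢 : ℕ → MeasurableSpace Ω} {c ξ : ℕ → Ω → ℝ} {v : ℕ → ℝ}

/-- A martingale transform has second moment at most the expected predictable bracket. -/
theorem integral_sq_transform_le (h𝒢 : Monotone 𝒢) (hle : ∀ j, 𝒢 j ≤ mΩ)
    (hc : ∀ j, Measurable[𝒢 j] (c j)) (hcb : ∀ j, ∃ C, ∀ ω, |c j ω| ≤ C)
    (hξm : ∀ j, Measurable[𝒢 (j + 1)] (ξ j)) (hξ2 : ∀ j, MemLp (ξ j) 2 P)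
    (hξ0 : ∀ j, ∫ ω, ξ j ω ∂P = 0) (hξv : ∀ j, ∫ ω, ξ j ω ^ 2 ∂P ≤ v j)
    (hind : ∀ j, Indep (MeasurableSpace.comap (ξ j) inferInstance) (𝒢 j) P) (n : ℕ) :
    ∫ ω, (∑ j ∈ Finset.range n, c j ω * ξ j ω) ^ 2 ∂P
      ≤ ∫ ω, ∑ j ∈ Finset.range n, c j ω ^ 2 * v j ∂P := by
  have hcm : ∀ j, Measurable (c j) := fun j => (hc j).mono (hle j) le_rfl
  have hS2 : ∀ n, MemLp (fun ω => ∑ j ∈ Finset.range n, c j ω * ξ j ω) 2 P := fun n =>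
    memLp_finsetSum _ fun j _ => memLp_two_bdd_mul (hcm j) (hcb j) (hξ2 j)
  have hSm : ∀ n, Measurable[𝒢 n] (fun ω => ∑ j ∈ Finset.range n, c j ω * ξ j ω) := fun n =>
    Finset.measurable_fun_sum _ fun j hj =>
      ((hc j).mono (h𝒢 (Finset.mem_range.1 hj).le) le_rfl).mul
        ((hξm j).mono (h𝒢 (Finset.mem_range.1 hj)) le_rfl)
  have hci : ∀ j, Integrable (fun ω => c j ω ^ 2) P := fun j => by
    obtain ⟨C, hC⟩ := hcb j
    refine Integrable.of_bound ((hcm j).pow_const 2).aestronglyMeasurable (C ^ 2)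
      (ae_of_all _ fun ω => ?_)
    rw [norm_pow]
    exact pow_le_pow_left₀ (norm_nonneg _) (hC ω) 2
  have hcv : ∀ j, Integrable (fun ω => c j ω ^ 2 * v j) P := fun j => (hci j).mul_const _
  induction n with
  | zero => simp
  | succ n ih =>
    simp only [Finset.sum_range_succ]
    set S : Ω → ℝ := fun ω => ∑ j ∈ Finset.range n, c j ω * ξ j ω with hS
    have hSn : MemLp S 2 P := hS2 n
    have hSi : Integrable (fun ω => S ω ^ 2) P := hSn.integrable_sq
    have hSc : Integrable (fun ω => S ω ^ 2 + 2 * (S ω * (c n ω * ξ n ω))) P :=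
      hSi.add ((hSn.integrable_mul (memLp_two_bdd_mul (hcm n) (hcb n) (hξ2 n))).const_mul 2)
    have hcξ := memLp_two_bdd_mul (hcm n) (hcb n) (hξ2 n)
    have indep_of : ∀ {Y : Ω → ℝ} {u : ℝ → ℝ}, Measurable[𝒢 n] Y → Measurable u →
        IndepFun Y (fun ω => u (ξ n ω)) P := fun {Y u} hY hu => by
      have h1 : Indep (MeasurableSpace.comap Y inferInstance)
          (MeasurableSpace.comap (ξ n) inferInstance) P :=
        indep_of_indep_of_le_left (hind n).symm (hY.comap_le)
      have h2 : IndepFun Y (ξ n) P := (IndepFun_iff_Indep _ _ _).2 h1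
      exact h2.comp measurable_id hu
    -- Orthogonality: `S` and `c n` are known at time `n`, whereas `ξ n` is centred and independent
    -- of that past.
    have hcross : ∫ ω, S ω * (c n ω * ξ n ω) ∂P = 0 := by
      have hY : Measurable[𝒢 n] (fun ω => S ω * c n ω) := (hSm n).mul (hc n)
      have := (indep_of hY measurable_id).integral_fun_mul_eq_mul_integral
        (hY.mono (hle n) le_rfl).aestronglyMeasurable (hξ2 n).1
      simp only [id] at this
      rw [hξ0 n, mul_zero] at this
      rw [← this]
      congr 1; ext ω; ring
    have hsq : ∫ ω, (c n ω * ξ n ω) ^ 2 ∂P ≤ ∫ ω, c n ω ^ 2 * v n ∂P := by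
      have hY : Measurable[𝒢 n] (fun ω => c n ω ^ 2) := (hc n).pow_const 2
      have := (indep_of (u := fun x => x ^ 2) hY (by fun_prop)).integral_fun_mul_eq_mul_integral
        (hY.mono (hle n) le_rfl).aestronglyMeasurable ((hξ2 n).1.pow 2)
      simp only [mul_pow]
      rw [this, integral_mul_const]
      exact mul_le_mul_of_nonneg_left (hξv n) (integral_nonneg fun _ => sq_nonneg _)
    have hcrossi : Integrable (fun ω => S ω * (c n ω * ξ n ω)) P := hSn.integrable_mul hcξ
    have e : ∀ ω, (∑ j ∈ Finset.range n, c j ω * ξ j ω + c n ω * ξ n ω) ^ 2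
        = S ω ^ 2 + 2 * (S ω * (c n ω * ξ n ω)) + (c n ω * ξ n ω) ^ 2 := fun ω => by simp only [hS]; ring
    simp only [e]
    rw [integral_add hSc hcξ.integrable_sq,
      integral_add hSi (hcrossi.const_mul 2), integral_const_mul, hcross,
      integral_add (integrable_finsetSum _ fun j _ => hcv j) (hcv n)]
    change ∫ ω, S ω ^ 2 ∂P ≤ _ at ih
    linarith

/-- A martingale transform is small in probability when its predictable bracket is. -/
theorem measure_transform_ge_le (h𝒢 : Monotone 𝒢) (hle : ∀ j, 𝒢 j ≤ mΩ)
    (hc : ∀ j, Measurable[𝒢 j] (c j)) (hcb : ∀ j, ∃ C, ∀ ω, |c j ω| ≤ C)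
    (hξm : ∀ j, Measurable[𝒢 (j + 1)] (ξ j)) (hξ2 : ∀ j, MemLp (ξ j) 2 P)
    (hξ0 : ∀ j, ∫ ω, ξ j ω ∂P = 0) (hξv : ∀ j, ∫ ω, ξ j ω ^ 2 ∂P ≤ v j) (hv : ∀ j, 0 ≤ v j)
    (hind : ∀ j, Indep (MeasurableSpace.comap (ξ j) inferInstance) (𝒢 j) P) (n : ℕ)
    {ε η : ℝ} (hε : 0 < ε) (hη : 0 ≤ η) :
    P {ω | ε ≤ |∑ j ∈ Finset.range n, c j ω * ξ j ω|}
      ≤ P {ω | η < ∑ j ∈ Finset.range n, c j ω ^ 2 * v j} + ENNReal.ofReal (η / ε ^ 2) := by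
  classical
  let V : ℕ → Ω → ℝ := fun j ω => ∑ i ∈ Finset.range j, c i ω ^ 2 * v i
  have hVm : ∀ j, Measurable[𝒢 j] (V (j + 1)) := fun j =>
    Finset.measurable_fun_sum _ fun i hi =>
      (((hc i).mono (h𝒢 (Nat.lt_succ_iff.1 (Finset.mem_range.1 hi))) le_rfl).pow_const 2).mul_const _
  -- The transform is switched off before the step that would push the bracket above `η`. This is
  -- predictable, because `V (j + 1)` involves only `c 0, …, c j`.
  let b : ℕ → Ω → ℝ := fun j ω => if V (j + 1) ω ≤ η then c j ω else 0
  have hb : ∀ j, Measurable[𝒢 j] (b j) := fun j =>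
    Measurable.ite (@measurableSet_le _ Ω _ _ _ (𝒢 j) _ _ _ _ _ (hVm j) measurable_const) (hc j)
      measurable_const
  have hbb : ∀ j, ∃ C, ∀ ω, |b j ω| ≤ C := fun j => by
    obtain ⟨C, hC⟩ := hcb j
    refine ⟨C, fun ω => ?_⟩
    by_cases h : V (j + 1) ω ≤ η
    · simpa [b, h] using hC ω
    · simpa [b, h] using (abs_nonneg _).trans (hC ω)
  -- The induction needs both bounds: comparison with `V` handles an active step, and the bound `η`
  -- survives a switched-off step.
  have hbV : ∀ n ω, ∑ j ∈ Finset.range n, b j ω ^ 2 * v j ≤ η ∧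
      ∑ j ∈ Finset.range n, b j ω ^ 2 * v j ≤ V n ω := by
    intro n ω
    induction n with
    | zero => simpa [V] using hη
    | succ n ih =>
      have hV : V (n + 1) ω = V n ω + c n ω ^ 2 * v n := Finset.sum_range_succ _ _
      have hnn : 0 ≤ c n ω ^ 2 * v n := mul_nonneg (sq_nonneg _) (hv n)
      rw [Finset.sum_range_succ]
      by_cases h : V (n + 1) ω ≤ η
      · simp only [b, h, if_true] at ih ⊢
        constructor <;> linarith [ih.2]
      · simp only [b, h, if_false] at ih ⊢
        constructor <;> nlinarith [ih.1, ih.2]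
  have hm2 : MemLp (fun ω => ∑ j ∈ Finset.range n, b j ω * ξ j ω) 2 P :=
    memLp_finsetSum _ fun j _ => memLp_two_bdd_mul ((hb j).mono (hle j) le_rfl) (hbb j) (hξ2 j)
  have hsq : ∫ ω, (∑ j ∈ Finset.range n, b j ω * ξ j ω) ^ 2 ∂P ≤ η := by
    refine (integral_sq_transform_le h𝒢 hle hb hbb hξm hξ2 hξ0 hξv hind n).trans ?_
    refine (integral_mono_of_nonneg (ae_of_all _ fun ω => Finset.sum_nonneg fun j _ =>
      mul_nonneg (sq_nonneg _) (hv j)) (integrable_const η) (ae_of_all _ fun ω => (hbV n ω).1)).trans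
      ?_
    simp
  have hcheb : P {ω | ε ≤ |∑ j ∈ Finset.range n, b j ω * ξ j ω|} ≤ ENNReal.ofReal (η / ε ^ 2) := by
    have h1 := mul_meas_ge_le_integral_of_nonneg (μ := P)
      (ae_of_all _ fun ω => sq_nonneg (∑ j ∈ Finset.range n, b j ω * ξ j ω)) hm2.integrable_sq
      (ε ^ 2)
    have h2 : {ω | ε ≤ |∑ j ∈ Finset.range n, b j ω * ξ j ω|}
        = {ω | ε ^ 2 ≤ (∑ j ∈ Finset.range n, b j ω * ξ j ω) ^ 2} := by
      ext ω
      simp only [mem_ofPred_eq]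
      rw [sq_le_sq, abs_of_pos hε]
    rw [h2, ← ENNReal.ofReal_toReal (measure_ne_top P _)]
    refine ENNReal.ofReal_le_ofReal ?_
    rw [le_div_iff₀ (by positivity), mul_comm]
    exact h1.trans hsq
  refine le_trans (measure_mono (fun ω hω => ?_)) ((measure_union_le _ _).trans
    (add_le_add le_rfl hcheb))
  by_cases h : η < ∑ j ∈ Finset.range n, c j ω ^ 2 * v j
  · exact Or.inl h
  · right
    -- Where the full bracket is at most `η`, monotonicity shows that no step was switched off, so
    -- both transforms agree.
    have hVmono : Monotone fun j => V j ω := by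
      refine monotone_nat_of_le_succ fun j => ?_
      simp only [V]
      rw [Finset.sum_range_succ]
      exact le_add_of_nonneg_right (mul_nonneg (sq_nonneg _) (hv j))
    have : ∀ j ∈ Finset.range n, b j ω * ξ j ω = c j ω * ξ j ω := fun j hj => by
      have : V (j + 1) ω ≤ η := (hVmono (Finset.mem_range.1 hj)).trans (not_lt.1 h)
      simp [b, this]
    simp only [mem_ofPred_eq]
    rw [Finset.sum_congr rfl this]
    exact hω

end MartingaleTransform

/-! ### Common refinements of grids -/

section Refinement

/-- The points of a nonempty finite set of reals, listed in increasing order and then repeating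
the largest one. -/
noncomputable def sortedPoint (S : Finset ℝ) (n : ℕ) (h : S.card = n + 1) (j : ℕ) : ℝ :=
  S.orderEmbOfFin h ⟨min j n, by omega⟩

variable {S : Finset ℝ} {n : ℕ} (h : S.card = n + 1)

theorem sortedPoint_mem (j : ℕ) : sortedPoint S n h j ∈ S := Finset.orderEmbOfFin_mem _ _ _

theorem sortedPoint_mono : Monotone (sortedPoint S n h) := fun _ _ hij =>
  (S.orderEmbOfFin h).monotone (Fin.mk_le_mk.2 (min_le_min_right _ hij))

theorem exists_sortedPoint_eq {a : ℝ} (ha : a ∈ S) : ∃ p : ℕ, p ≤ n ∧ sortedPoint S n h p = a := by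
  have : a ∈ Set.range (S.orderEmbOfFin h) := by simpa using ha
  obtain ⟨p, hp⟩ := this
  refine ⟨p.1, by omega, ?_⟩
  rw [← hp, sortedPoint]
  congr 1
  ext
  simp; omega

/-- No point of `S` lies strictly between two consecutive sorted points. -/
theorem le_sortedPoint_of_lt {a : ℝ} (ha : a ∈ S) {j : ℕ} (haj : a < sortedPoint S n h (j + 1)) :
    a ≤ sortedPoint S n h j := by
  obtain ⟨p, hp, rfl⟩ := exists_sortedPoint_eq h ha
  refine sortedPoint_mono h ?_
  by_contra hj
  exact absurd haj (not_lt.2 (sortedPoint_mono h (by omega)))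

/-- The sum of the increments of `w` over the steps of a refined grid inside `(a, b]`. -/
theorem sum_indicator_mul_increment (w : ℝ → ℝ) {a b : ℝ} (hab : a ≤ b) (ha : a ∈ S) (hb : b ∈ S)
    (x : ℝ) :
    ∑ j ∈ Finset.range n, (Ioc a b).indicator (fun _ => x) (sortedPoint S n h (j + 1)) *
      (w (sortedPoint S n h (j + 1)) - w (sortedPoint S n h j)) = x * (w b - w a) := by
  -- Clamping the argument of `w` to `[a, b]` leaves the increments inside unchanged and kills those
  -- outside, so the sum telescopes.
  have key : ∀ j, (Ioc a b).indicator (fun _ => x) (sortedPoint S n h (j + 1)) *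
      (w (sortedPoint S n h (j + 1)) - w (sortedPoint S n h j))
      = x * w (max a (min b (sortedPoint S n h (j + 1))))
        - x * w (max a (min b (sortedPoint S n h j))) := by
    intro j
    have hm := sortedPoint_mono h (Nat.le_succ j)
    rw [Nat.succ_eq_add_one] at hm
    rcases le_or_gt (sortedPoint S n h (j + 1)) a with h1 | h1
    · rw [indicator_of_notMem (fun hh => absurd hh.1 (not_lt.2 h1)), min_eq_right (h1.trans hab),
        min_eq_right ((hm.trans h1).trans hab), max_eq_left h1, max_eq_left (hm.trans h1)]
      ring
    have h1' := le_sortedPoint_of_lt h ha h1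
    rcases le_or_gt (sortedPoint S n h (j + 1)) b with h2 | h2
    · rw [indicator_of_mem (show _ ∈ Ioc a b from ⟨h1, h2⟩), min_eq_right h2, min_eq_right (hm.trans h2),
        max_eq_right h1.le, max_eq_right h1']
      ring
    · have h2' := le_sortedPoint_of_lt h hb h2
      rw [indicator_of_notMem (fun hh => absurd hh.2 (not_le.2 h2)), min_eq_left h2.le,
        min_eq_left h2']
      ring
  rw [Finset.sum_congr rfl fun j _ => key j, Finset.sum_range_sub (fun j =>
    x * w (max a (min b (sortedPoint S n h j))))]
  obtain ⟨p, hp, hpa⟩ := exists_sortedPoint_eq h ha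
  obtain ⟨q, hq, hqb⟩ := exists_sortedPoint_eq h hb
  have h0 : sortedPoint S n h 0 ≤ a := hpa ▸ sortedPoint_mono h (Nat.zero_le p)
  have hn : b ≤ sortedPoint S n h n := hqb ▸ sortedPoint_mono h hq
  rw [min_eq_left hn, min_eq_right (h0.trans hab), max_eq_left h0, max_eq_right hab]
  ring

end Refinement

namespace ElementaryProcess

variable {Ω : Type*} {mΩ : MeasurableSpace Ω} {ℱ : Filtration ℝ≥0 mΩ} {t T : ℝ}

/-- The grid points of an elementary process. -/
noncomputable def points (φ : ElementaryProcess ℱ t T) : Finset ℝ :=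
  (Finset.range (φ.n + 1)).image φ.grid

/-- On a grid containing all of its own points the process is constant on each step, and the right
endpoint carries that constant because the intervals are closed on the right. Two processes written
on a common grid can then be subtracted term by term. -/
theorem integral_eq_sum_refined (φ : ElementaryProcess ℱ t T) (W : ℝ≥0 → Ω → ℝ) (s : ℝ) (ω : Ω)
    {S : Finset ℝ} {n : ℕ} (h : S.card = n + 1) (hS : φ.points ⊆ S) :
    φ.integral W s ω = ∑ j ∈ Finset.range n, φ.value (sortedPoint S n h (j + 1)) ω *
      (W (min (sortedPoint S n h (j + 1)) s).toNNReal ω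
        - W (min (sortedPoint S n h j) s).toNNReal ω) := by
  have hmem : ∀ i ≤ φ.n, φ.grid i ∈ S := fun _ hi =>
    hS (Finset.mem_image_of_mem _ (Finset.mem_range.2 (by omega)))
  simp only [value, Finset.sum_mul]
  rw [Finset.sum_comm, integral]
  refine Finset.sum_congr rfl fun i hi => ?_
  have hi := Finset.mem_range.1 hi
  exact (sum_indicator_mul_increment h (fun u => W (min u s).toNNReal ω)
    (φ.grid_mono (Nat.le_succ i)) (hmem i hi.le) (hmem (i + 1) hi) (φ.coef i ω)).symm

theorem value_eq_of_mem (φ : ElementaryProcess ℱ t T) (ω : Ω)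
    {S : Finset ℝ} {n : ℕ} (h : S.card = n + 1) (hS : φ.points ⊆ S) {j : ℕ} {s : ℝ}
    (hs : s ∈ Ioc (sortedPoint S n h j) (sortedPoint S n h (j + 1))) :
    φ.value s ω = φ.value (sortedPoint S n h (j + 1)) ω := by
  have hmem : ∀ i ≤ φ.n, φ.grid i ∈ S := fun _ hi =>
    hS (Finset.mem_image_of_mem _ (Finset.mem_range.2 (by omega)))
  have hlt : sortedPoint S n h j < sortedPoint S n h (j + 1) := hs.1.trans_le hs.2
  refine Finset.sum_congr rfl fun i hi => ?_
  have hi := Finset.mem_range.1 hi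
  have e : ∀ a ∈ S, (a < s ↔ a < sortedPoint S n h (j + 1)) := fun a ha =>
    ⟨fun hh => hh.trans_le hs.2, fun hh => (le_sortedPoint_of_lt h ha hh).trans_lt hs.1⟩
  have h1 := e _ (hmem i hi.le)
  have h2 := e _ (hmem (i + 1) hi)
  have h2' : s ≤ φ.grid (i + 1) ↔ sortedPoint S n h (j + 1) ≤ φ.grid (i + 1) := by
    rw [← not_lt, h2, not_lt]
  simp only [indicator, mem_Ioc, h1, h2']

/-- Predictability: if the right endpoint of a step lies in `(grid i, grid (i + 1)]`, then `grid i`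
is at most the left endpoint, where `coef i` is already known. -/
theorem measurable_value_sortedPoint (φ : ElementaryProcess ℱ t T)
    {S : Finset ℝ} {n : ℕ} (h : S.card = n + 1) (hS : φ.points ⊆ S) (j : ℕ) :
    Measurable[ℱ (sortedPoint S n h j).toNNReal] (φ.value (sortedPoint S n h (j + 1))) := by
  have hmem : ∀ i ≤ φ.n, φ.grid i ∈ S := fun _ hi =>
    hS (Finset.mem_image_of_mem _ (Finset.mem_range.2 (by omega)))
  refine Finset.measurable_fun_sum _ fun i hi => ?_
  have hi := Finset.mem_range.1 hi
  by_cases hj : sortedPoint S n h (j + 1) ∈ Ioc (φ.grid i) (φ.grid (i + 1))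
  · simp only [indicator_of_mem hj]
    exact (φ.coef_meas i).mono
      (ℱ.mono (Real.toNNReal_le_toNNReal (le_sortedPoint_of_lt h (hmem i hi.le) hj.1))) le_rfl
  · simp only [indicator_of_notMem hj]
    exact measurable_const

theorem bounded_value (φ : ElementaryProcess ℱ t T) : ∃ C, ∀ s ω, |φ.value s ω| ≤ C := by
  obtain ⟨C, hC⟩ := φ.coef_bdd
  refine ⟨∑ _i ∈ Finset.range φ.n, |C|, fun s ω => (Finset.abs_sum_le_sum_abs _ _).trans
    (Finset.sum_le_sum fun i _ => ?_)⟩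
  by_cases hj : s ∈ Ioc (φ.grid i) (φ.grid (i + 1))
  · rw [indicator_of_mem hj]; exact (hC i ω).trans (le_abs_self _)
  · rw [indicator_of_notMem hj]; simp

end ElementaryProcess

/-! ### Gaussian increments of Brownian motion -/

section Increments

variable {Ω : Type*} {mΩ : MeasurableSpace Ω} {P : Measure Ω} {ℱ : Filtration ℝ≥0 mΩ}
  {W : ℝ≥0 → Ω → ℝ}

theorem IsFilteredBrownian.hasLaw_increment (hW : IsFilteredBrownian ℱ P W) (a b : ℝ≥0) :
    HasLaw (fun ω => W b ω - W a ω) (gaussianReal 0 (nndist (b : ℝ) a)) P :=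
  hW.isBrownian.hasLaw_sub b a

theorem IsFilteredBrownian.integral_increment (hW : IsFilteredBrownian ℱ P W) (a b : ℝ≥0) :
    ∫ ω, (W b ω - W a ω) ∂P = 0 := by
  rw [(hW.hasLaw_increment a b).integral_eq, integral_id_gaussianReal]

theorem IsFilteredBrownian.memLp_increment (hW : IsFilteredBrownian ℱ P W) (a b : ℝ≥0) :
    MemLp (fun ω => W b ω - W a ω) 2 P :=
  (hW.hasLaw_increment a b).hasGaussianLaw.memLp_two

theorem IsFilteredBrownian.integral_increment_sq (hW : IsFilteredBrownian ℱ P W) {a b : ℝ≥0}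
    (hab : a ≤ b) : ∫ ω, (W b ω - W a ω) ^ 2 ∂P = b - a := by
  have h1 := (hW.hasLaw_increment a b).variance_eq
  rw [variance_id_gaussianReal,
    variance_of_integral_eq_zero (hW.hasLaw_increment a b).aemeasurable
      (hW.integral_increment a b)] at h1
  rw [h1, coe_nndist, Real.dist_eq, abs_of_nonneg (sub_nonneg.2 (NNReal.coe_le_coe.2 hab))]

theorem IsFilteredBrownian.measurable (hW : IsFilteredBrownian ℱ P W) {a b : ℝ≥0} (hab : a ≤ b) :
    Measurable[ℱ b] (W a) := (hW.adapted a).mono (ℱ.mono hab) le_rfl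

end Increments

namespace ElementaryProcess

variable {Ω : Type*} {mΩ : MeasurableSpace Ω} {P : Measure Ω} [IsProbabilityMeasure P]
  {ℱ : Filtration ℝ≥0 mΩ} {W : ℝ≥0 → Ω → ℝ} {t T : ℝ}

/-- Two elementary processes that are close in `L²(dt)` have close stochastic integrals. -/
theorem measure_integral_sub_ge_le (hW : IsFilteredBrownian ℱ P W) (ht : 0 ≤ t)
    (φ ψ : ElementaryProcess ℱ t T) {s : ℝ} (hs : t ≤ s) {ε η : ℝ} (hε : 0 < ε) (hη : 0 ≤ η) :
    P {ω | ε ≤ |φ.integral W s ω - ψ.integral W s ω|}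
      ≤ P {ω | ENNReal.ofReal η
          ≤ ∫⁻ u in Icc t T, ENNReal.ofReal ((φ.value u ω - ψ.value u ω) ^ 2)}
        + ENNReal.ofReal (η / ε ^ 2) := by
  classical
  -- On the union of the two grids the difference of the integrals is a martingale transform, whose
  -- bracket is dominated by the `L²(dt)` distance.
  set S := φ.points ∪ ψ.points with hS
  have hφS : φ.points ⊆ S := Finset.subset_union_left
  have hψS : ψ.points ⊆ S := Finset.subset_union_right
  have hne : φ.grid 0 ∈ S := hφS (Finset.mem_image_of_mem _ (Finset.mem_range.2 (by omega)))
  obtain ⟨n, h⟩ : ∃ n, S.card = n + 1 :=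
    Nat.exists_eq_succ_of_ne_zero (Finset.card_ne_zero_of_mem hne)
  have hSmem : ∀ a ∈ S, a ∈ Icc t T := by
    intro a ha
    rcases Finset.mem_union.1 ha with ha | ha
    · obtain ⟨i, -, rfl⟩ := Finset.mem_image.1 ha; exact φ.grid_mem i
    · obtain ⟨i, -, rfl⟩ := Finset.mem_image.1 ha; exact ψ.grid_mem i
  set e := sortedPoint S n h with he
  have hemono : Monotone e := sortedPoint_mono h
  have hemem : ∀ j, e j ∈ Icc t T := fun j => hSmem _ (sortedPoint_mem h j)
  set c : ℕ → Ω → ℝ := fun j ω => φ.value (e (j + 1)) ω - ψ.value (e (j + 1)) ω with hc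
  set ξ : ℕ → Ω → ℝ := fun j ω =>
    W (min (e (j + 1)) s).toNNReal ω - W (min (e j) s).toNNReal ω with hξ
  have hint : ∀ ω, φ.integral W s ω - ψ.integral W s ω = ∑ j ∈ Finset.range n, c j ω * ξ j ω := by
    intro ω
    rw [φ.integral_eq_sum_refined W s ω h hφS, ψ.integral_eq_sum_refined W s ω h hψS,
      ← Finset.sum_sub_distrib]
    exact Finset.sum_congr rfl fun j _ => (sub_mul _ _ _).symm
  have hmin : ∀ j, (min (e j) s).toNNReal ≤ (min (e (j + 1)) s).toNNReal := fun j =>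
    Real.toNNReal_le_toNNReal (min_le_min_right _ (hemono (Nat.le_succ j)))
  have hcb : ∀ j, ∃ C, ∀ ω, |c j ω| ≤ C := fun j => by
    obtain ⟨C, hC⟩ := φ.bounded_value
    obtain ⟨D, hD⟩ := ψ.bounded_value
    exact ⟨C + D, fun ω => (abs_sub _ _).trans (add_le_add (hC _ ω) (hD _ ω))⟩
  have key := measure_transform_ge_le (P := P) (𝒢 := fun j => ℱ (e j).toNNReal) (c := c) (ξ := ξ)
    (v := fun j => e (j + 1) - e j)
    (fun _ _ hij => ℱ.mono (Real.toNNReal_le_toNNReal (hemono hij))) (fun j => ℱ.le _)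
    (fun j => (φ.measurable_value_sortedPoint h hφS j).sub
      (ψ.measurable_value_sortedPoint h hψS j)) hcb
    (fun j => (hW.measurable (Real.toNNReal_le_toNNReal (min_le_left _ _))).sub
      (hW.measurable (Real.toNNReal_le_toNNReal
        ((min_le_left _ _).trans (hemono (Nat.le_succ j))))))
    (fun j => hW.memLp_increment _ _) (fun j => hW.integral_increment _ _)
    -- Stopping the increments at `s` only lowers their variance, so the full step length is an
    -- upper bound.
    (fun j => by
      rw [hW.integral_increment_sq (hmin j)]
      have h1 := (hemem j).1
      rw [Real.coe_toNNReal _ (le_min (ht.trans (hemem _).1) (ht.trans hs)),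
        Real.coe_toNNReal _ (le_min (ht.trans (hemem _).1) (ht.trans hs))]
      have := hemono (Nat.le_succ j)
      rw [Nat.succ_eq_add_one] at this
      rcases min_cases (e (j + 1)) s with h | h <;> rcases min_cases (e j) s with h' | h' <;>
        linarith)
    (fun j => sub_nonneg.2 (hemono (Nat.le_succ j)))
    -- Before `s` the increment starts at `e j`; beyond `s` it vanishes and independence is trivial.
    (fun j => by
      rcases le_total (e j) s with hjs | hjs
      · have := hW.indep (min (e j) s).toNNReal (min (e (j + 1)) s).toNNReal (hmin j)
        rw [min_eq_left hjs] at this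
        simpa only [hξ, min_eq_left hjs] using this
      · have h0 : ξ j = fun _ => 0 := by
          ext ω
          simp only [hξ]
          rw [min_eq_right hjs, min_eq_right (hjs.trans (hemono (Nat.le_succ j))), sub_self]
        rw [h0, MeasurableSpace.comap_const]
        exact indep_bot_left _)
    n hε hη
  simp only [← hint] at key
  refine key.trans (add_le_add (measure_mono fun ω hω => ?_) le_rfl)
  simp only [mem_ofPred_eq] at hω ⊢
  refine (ENNReal.ofReal_le_ofReal hω.le).trans ?_
  rw [ENNReal.ofReal_sum_of_nonneg fun j _ =>
    mul_nonneg (sq_nonneg _) (sub_nonneg.2 (hemono (Nat.le_succ j)))]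
  have hstep : ∀ j, ENNReal.ofReal (c j ω ^ 2 * (e (j + 1) - e j))
      = ∫⁻ u in Ioc (e j) (e (j + 1)), ENNReal.ofReal ((φ.value u ω - ψ.value u ω) ^ 2) := by
    intro j
    rw [setLIntegral_congr_fun (g := fun _ => ENNReal.ofReal (c j ω ^ 2)) measurableSet_Ioc
      (fun u hu => by
        simp only [hc]
        rw [φ.value_eq_of_mem ω h hφS hu, ψ.value_eq_of_mem ω h hψS hu]),
      setLIntegral_const, Real.volume_Ioc, ENNReal.ofReal_mul (sq_nonneg _)]
  rw [Finset.sum_congr rfl fun j _ => hstep j, ← lintegral_biUnion_finset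
    (t := fun j => Ioc (e j) (e (j + 1))) (fun _i _ _j _ hij => (hemono.pairwise_disjoint_on_Ioc_succ hij)) (fun _ _ => measurableSet_Ioc)]
  refine lintegral_mono_set (iUnion₂_subset fun j _ => fun u hu => ?_)
  exact ⟨(hemem j).1.trans hu.1.le, hu.2.trans (hemem _).2⟩

end ElementaryProcess

/-! ## Uniqueness of the Itô integral -/

section Uniqueness

variable {Ω : Type*} {mΩ : MeasurableSpace Ω} {P : Measure Ω} [IsProbabilityMeasure P]
  {ℱ : Filtration ℝ≥0 mΩ} {W : ℝ≥0 → Ω → ℝ} {t T : ℝ} {f I J : ℝ → Ω → ℝ}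

theorem ElementaryProcess.measurable_value (φ : ElementaryProcess ℱ t T) (ω : Ω) :
    Measurable fun u => φ.value u ω :=
  Finset.measurable_fun_sum _ fun _ _ => measurable_const.indicator measurableSet_Ioc

theorem tendstoInMeasure_sub {α : Type*} {m : MeasurableSpace α} {μ : Measure α}
    {f g : ℕ → α → ℝ} {a b : α → ℝ} (hf : TendstoInMeasure μ f atTop a)
    (hg : TendstoInMeasure μ g atTop b) :
    TendstoInMeasure μ (fun k x => f k x - g k x) atTop (fun x => a x - b x) := by
  rw [tendstoInMeasure_iff_norm] at hf hg ⊢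
  intro ε hε
  have hlim := (hf (ε / 2) (half_pos hε)).add (hg (ε / 2) (half_pos hε))
  rw [add_zero] at hlim
  refine tendsto_of_tendsto_of_tendsto_of_le_of_le tendsto_const_nhds hlim
    (fun _ => zero_le) (fun k => (measure_mono fun x hx => ?_).trans (measure_union_le _ _))
  by_contra hcon
  simp only [mem_union, mem_ofPred_eq, not_or, not_le] at hcon hx
  have := norm_sub_le (f k x - a x) (g k x - b x)
  rw [show f k x - a x - (g k x - b x) = f k x - g k x - (a x - b x) by ring] at this
  linarith

/-- Two approximating sequences of the same integrand approach each other in `L²(dt)`, hence so do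
their integrals in probability, and limits in measure are a.e. unique. -/
theorem IsItoIntegral.ae_eq_at (hW : IsFilteredBrownian ℱ P W) (ht : 0 ≤ t)
    (hI : IsItoIntegral ℱ P W t T f I) (hJ : IsItoIntegral ℱ P W t T f J) {s : ℝ}
    (hs : s ∈ Icc t T) : I s =ᵐ[P] J s := by
  obtain ⟨φ, hφ, hφI⟩ := hI.approx
  obtain ⟨ψ, hψ, hψJ⟩ := hJ.approx
  have hL2 : ∀ η : ℝ, 0 < η → Tendsto (fun k => P {ω | ENNReal.ofReal η
      ≤ ∫⁻ u in Icc t T, ENNReal.ofReal (((φ k).value u ω - (ψ k).value u ω) ^ 2)})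
      atTop (𝓝 0) := by
    intro η hη
    -- From (x - y)² ≤ 2x² + 2y²: two errors below η/4 give a distance below η.
    have h4 : (0 : ℝ≥0∞) < ENNReal.ofReal (η / 4) := ENNReal.ofReal_pos.2 (by linarith)
    have hlim := (hφ _ h4).add (hψ _ h4)
    rw [add_zero] at hlim
    refine tendsto_of_tendsto_of_tendsto_of_le_of_le tendsto_const_nhds hlim
      (fun _ => zero_le) (fun k => (measure_mono fun ω hω => ?_).trans (measure_union_le _ _))
    by_contra hcon
    simp only [mem_union, mem_ofPred_eq, not_or, not_le] at hcon hω
    have hfm : Measurable fun u => f u ω :=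
      hI.integrand_measurable.comp (measurable_id.prodMk measurable_const)
    have hφm := (φ k).measurable_value ω
    have hψm := (ψ k).measurable_value ω
    have hle : ∫⁻ u in Icc t T, ENNReal.ofReal (((φ k).value u ω - (ψ k).value u ω) ^ 2)
        ≤ 2 * (∫⁻ u in Icc t T, ENNReal.ofReal (((φ k).value u ω - f u ω) ^ 2))
          + 2 * ∫⁻ u in Icc t T, ENNReal.ofReal (((ψ k).value u ω - f u ω) ^ 2) := by
      rw [← lintegral_const_mul _ (by fun_prop), ← lintegral_const_mul _ (by fun_prop),
        ← lintegral_add_left (by fun_prop)]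
      refine lintegral_mono fun u => ?_
      have h2 : (2 : ℝ≥0∞) = ENNReal.ofReal 2 := by simp
      rw [h2, ← ENNReal.ofReal_mul (by norm_num), ← ENNReal.ofReal_mul (by norm_num),
        ← ENNReal.ofReal_add (by positivity) (by positivity)]
      refine ENNReal.ofReal_le_ofReal ?_
      nlinarith [sq_nonneg (((φ k).value u ω - f u ω) + ((ψ k).value u ω - f u ω))]
    have hlt : 2 * (∫⁻ u in Icc t T, ENNReal.ofReal (((φ k).value u ω - f u ω) ^ 2))
          + 2 * ∫⁻ u in Icc t T, ENNReal.ofReal (((ψ k).value u ω - f u ω) ^ 2)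
          < ENNReal.ofReal η := by
      have e : ENNReal.ofReal η = 2 * ENNReal.ofReal (η / 4) + 2 * ENNReal.ofReal (η / 4) := by
        have h2 : (2 : ℝ≥0∞) = ENNReal.ofReal 2 := by simp
        rw [h2, ← ENNReal.ofReal_mul (by norm_num), ← ENNReal.ofReal_add (by positivity)
          (by positivity)]
        congr 1; ring
      rw [e]
      exact ENNReal.add_lt_add
        ((ENNReal.mul_lt_mul_iff_right (by norm_num) (by norm_num)).2 hcon.1)
        ((ENNReal.mul_lt_mul_iff_right (by norm_num) (by norm_num)).2 hcon.2)
    exact absurd hω (not_le.2 (hle.trans_lt hlt))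
  have hsub : TendstoInMeasure P (fun k ω => (φ k).integral W s ω - (ψ k).integral W s ω) atTop
      (fun _ => 0) := by
    rw [tendstoInMeasure_iff_norm]
    intro ε hε
    simp only [sub_zero, Real.norm_eq_abs]
    rw [ENNReal.tendsto_nhds_zero]
    intro κ hκ
    -- `η` makes the Chebyshev term at most half of the tolerance `κ`; for infinite `κ` any value
    -- works.
    obtain ⟨η, hη, hηκ⟩ : ∃ η : ℝ, 0 < η ∧ ENNReal.ofReal (η / ε ^ 2) ≤ κ / 2 := by
      rcases eq_or_ne κ ⊤ with rfl | hκt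
      · exact ⟨1, one_pos, by simp [ENNReal.top_div]⟩
      · refine ⟨κ.toReal / 2 * ε ^ 2, by
          have := ENNReal.toReal_pos hκ.ne' hκt
          positivity, ?_⟩
        rw [mul_div_assoc, div_self (by positivity), mul_one,
          ENNReal.ofReal_div_of_pos two_pos, ENNReal.ofReal_toReal hκt]
        simp
    have hκ2 : 0 < κ / 2 := ENNReal.div_pos hκ.ne' (by norm_num)
    filter_upwards [(ENNReal.tendsto_nhds_zero.1 (hL2 η hη)) (κ / 2) hκ2] with k hk
    calc _ ≤ _ := ElementaryProcess.measure_integral_sub_ge_le hW ht (φ k) (ψ k) hs.1 hε hη.le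
      _ ≤ κ / 2 + κ / 2 := add_le_add hk hηκ
      _ = κ := ENNReal.add_halves κ
  have hsub' : TendstoInMeasure P (fun k ω => (φ k).integral W s ω - (ψ k).integral W s ω) atTop
      (fun ω => I s ω - J s ω) := tendstoInMeasure_sub (hφI s hs) (hψJ s hs)
  have := tendstoInMeasure_ae_unique hsub hsub'
  filter_upwards [this] with ω hω
  linarith

/-- The Itô integral is unique up to indistinguishability. -/
theorem IsItoIntegral.indistinguishable (hW : IsFilteredBrownian ℱ P W) (ht : 0 ≤ t)
    (hI : IsItoIntegral ℱ P W t T f I) (hJ : IsItoIntegral ℱ P W t T f J) :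
    ∀ᵐ ω ∂P, ∀ s ∈ Icc t T, I s ω = J s ω := by
  -- Equality at each time is almost sure with a null set depending on the time; a countable dense
  -- set and path continuity give one null set for all times.
  obtain ⟨D, hDc, hDd⟩ := TopologicalSpace.exists_countable_dense (Icc t T)
  have : ∀ᵐ ω ∂P, ∀ q ∈ D, I q ω = J q ω :=
    (ae_ball_iff hDc).2 fun q _ => hI.ae_eq_at hW ht hJ q.2
  filter_upwards [this, hI.continuous, hJ.continuous] with ω h1 h2 h3 s hs
  exact congrFun (Continuous.ext_on hDd h2.domRestrict h3.domRestrict fun q hq => h1 q hq) ⟨s, hs⟩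

end Uniqueness

/-! ## Riemann–Stieltjes sums on uniform grids -/

section UniformGrid

/-- The uniform grid with `k + 1` steps on `[a, b]`, constant after its last point. -/
noncomputable def uniformGrid (a b : ℝ) (k i : ℕ) : ℝ := a + min ((i : ℝ) / (k + 1)) 1 * (b - a)

variable {a b : ℝ}

theorem uniformGrid_mono (hab : a ≤ b) (k : ℕ) : Monotone (uniformGrid a b k) := by
  intro i j hij
  unfold uniformGrid
  have : (i : ℝ) ≤ j := by exact_mod_cast hij
  have h0 : 0 ≤ b - a := sub_nonneg.2 hab
  gcongr

theorem uniformGrid_zero (k : ℕ) : uniformGrid a b k 0 = a := by simp [uniformGrid]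

theorem uniformGrid_last (k : ℕ) : uniformGrid a b k (k + 1) = b := by
  unfold uniformGrid
  rw [Nat.cast_add, Nat.cast_one, div_self (by positivity), min_self]; ring

theorem uniformGrid_mem (hab : a ≤ b) (k i : ℕ) : uniformGrid a b k i ∈ Icc a b := by
  have h0 : 0 ≤ b - a := sub_nonneg.2 hab
  have h1 : 0 ≤ min ((i : ℝ) / (k + 1)) 1 := by positivity
  have h2 : min ((i : ℝ) / (k + 1)) 1 ≤ 1 := min_le_right _ _
  unfold uniformGrid
  constructor <;> nlinarith

theorem exists_mem_Ioc_uniformGrid (k : ℕ) {s : ℝ} (hs : s ∈ Ioc a b) :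
    ∃ i ≤ k, s ∈ Ioc (uniformGrid a b k i) (uniformGrid a b k (i + 1)) := by
  classical
  have hex : ∃ i, s ≤ uniformGrid a b k i := ⟨k + 1, by rw [uniformGrid_last]; exact hs.2⟩
  obtain ⟨i, hi⟩ : ∃ i, Nat.find hex = i + 1 := by
    refine Nat.exists_eq_succ_of_ne_zero fun h0 => ?_
    have := Nat.find_spec hex
    rw [h0, uniformGrid_zero] at this
    exact absurd hs.1 (not_lt.2 this)
  have hlt : ¬ s ≤ uniformGrid a b k i := Nat.find_min hex (by omega)
  have hle : Nat.find hex ≤ k + 1 := Nat.find_min' hex (by rw [uniformGrid_last]; exact hs.2)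
  have hsp := Nat.find_spec hex
  rw [hi] at hsp
  exact ⟨i, by omega, not_le.1 hlt, hsp⟩

theorem uniformGrid_step (hab : a ≤ b) (k i : ℕ) :
    uniformGrid a b k (i + 1) - uniformGrid a b k i ≤ (b - a) / (k + 1) := by
  have h0 : 0 ≤ b - a := sub_nonneg.2 hab
  have hk : (0 : ℝ) < k + 1 := by positivity
  have h1 : min (((i + 1 : ℕ) : ℝ) / (k + 1)) 1 ≤ min ((i : ℝ) / (k + 1)) 1 + 1 / (k + 1) := by
    rw [Nat.cast_add, Nat.cast_one, add_div, ← min_add_add_right]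
    exact min_le_min_left _ (le_add_of_nonneg_right (by positivity))
  unfold uniformGrid
  have := mul_le_mul_of_nonneg_right h1 h0
  rw [div_eq_mul_one_div (b - a)]
  nlinarith

theorem tendsto_uniformGrid_step : Tendsto (fun k : ℕ => (b - a) / ((k : ℝ) + 1)) atTop (𝓝 0) :=
  tendsto_const_nhds.div_atTop (tendsto_natCast_atTop_atTop.atTop_add tendsto_const_nhds)

theorem exists_abs_uniformGrid_sub_le (hab : a ≤ b) (k : ℕ) {s : ℝ} (hs : s ∈ Icc a b) :
    ∃ i ≤ k + 1, |uniformGrid a b k i - s| ≤ (b - a) / (k + 1) := by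
  rcases eq_or_lt_of_le hs.1 with rfl | has
  · refine ⟨0, by omega, ?_⟩
    rw [uniformGrid_zero, sub_self, abs_zero]
    exact div_nonneg (sub_nonneg.2 hab) (by positivity)
  · obtain ⟨i, hi, his⟩ := exists_mem_Ioc_uniformGrid k ⟨has, hs.2⟩
    refine ⟨i + 1, by omega, ?_⟩
    rw [abs_of_nonneg (sub_nonneg.2 his.2)]
    linarith [uniformGrid_step hab k i, his.1]

theorem sum_increment_uniformGrid (f : ℝ → ℝ) (k : ℕ) :
    ∑ i ∈ Finset.range (k + 1), (f (uniformGrid a b k (i + 1)) - f (uniformGrid a b k i))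
      = f b - f a := by
  rw [Finset.sum_range_sub (fun i => f (uniformGrid a b k i)), uniformGrid_last, uniformGrid_zero]

/-- Uniform continuity bounds the error on each step by `κ` times the increment of `F`, and these
increments telescope. Right endpoints are used because summation by parts produces them. -/
theorem tendsto_riemannStieltjes_sum (F : StieltjesFunction ℝ) {w : ℝ → ℝ} (hab : a ≤ b)
    (hw : ContinuousOn w (Icc a b)) :
    Tendsto (fun k : ℕ => ∑ i ∈ Finset.range (k + 1),
      (F (uniformGrid a b k (i + 1)) - F (uniformGrid a b k i)) * w (uniformGrid a b k (i + 1)))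
      atTop (𝓝 (∫ u in a..b, w u ∂F.measure)) := by
  have huc := isCompact_Icc.uniformContinuousOn_of_continuous hw
  rw [Metric.tendsto_atTop]
  intro ε hε
  have hF : 0 ≤ F b - F a := sub_nonneg.2 (F.mono hab)
  -- The added 1 keeps the denominator positive when `F` is constant on the interval.
  set κ := ε / (F b - F a + 1) with hκ
  have hκ0 : 0 < κ := by positivity
  obtain ⟨δ, hδ, H⟩ := Metric.uniformContinuousOn_iff.1 huc κ hκ0
  obtain ⟨N, hN⟩ := Metric.tendsto_atTop.1 (tendsto_uniformGrid_step (a := a) (b := b)) δ hδ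
  refine ⟨N, fun k hk => ?_⟩
  have hstep : (b - a) / ((k : ℝ) + 1) < δ := by
    have := hN k hk
    rw [Real.dist_eq, sub_zero] at this
    exact (le_abs_self _).trans_lt this
  set e := uniformGrid a b k with he
  have hmono := uniformGrid_mono hab k
  have hi : ∀ i, IntervalIntegrable w F.measure (e i) (e (i + 1)) := fun i =>
    (hw.mono (uIcc_subset_Icc (uniformGrid_mem hab k i)
      (uniformGrid_mem hab k (i + 1)))).intervalIntegrable
  have hsplit : ∫ u in a..b, w u ∂F.measure
      = ∑ i ∈ Finset.range (k + 1), ∫ u in (e i)..(e (i + 1)), w u ∂F.measure := by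
    rw [intervalIntegral.sum_integral_adjacent_intervals fun i _ => hi i, he, uniformGrid_last,
      uniformGrid_zero]
  have hmeas : ∀ i, F.measure.real (Ioc (e i) (e (i + 1))) = F (e (i + 1)) - F (e i) := fun i => by
    rw [Measure.real, F.measure_Ioc,
      ENNReal.toReal_ofReal (sub_nonneg.2 (F.mono (hmono (Nat.le_succ i))))]
  rw [Real.dist_eq, hsplit, ← Finset.sum_sub_distrib]
  refine ((Finset.abs_sum_le_sum_abs _ _).trans (Finset.sum_le_sum (g := fun i =>
    κ * (F (e (i + 1)) - F (e i))) fun i _ => ?_)).trans_lt ?_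
  · have hle : e i ≤ e (i + 1) := hmono (Nat.le_succ i)
    have hc : (F (e (i + 1)) - F (e i)) * w (e (i + 1))
        = ∫ _u in (e i)..(e (i + 1)), w (e (i + 1)) ∂F.measure := by
      rw [intervalIntegral.integral_of_le hle, setIntegral_const, hmeas, smul_eq_mul]
    rw [hc, ← intervalIntegral.integral_sub (by simp) (hi i),
      intervalIntegral.integral_of_le hle, ← Real.norm_eq_abs, ← hmeas]
    refine norm_setIntegral_le_of_norm_le_const (by simp [F.measure_Ioc]) fun u hu => ?_
    have hui : u ∈ Icc a b :=
      ⟨(uniformGrid_mem hab k i).1.trans hu.1.le, hu.2.trans (uniformGrid_mem hab k (i + 1)).2⟩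
    refine (H _ (uniformGrid_mem hab k (i + 1)) _ hui ?_).le
    rw [Real.dist_eq, abs_of_nonneg (sub_nonneg.2 hu.2)]
    have := uniformGrid_step hab k i
    linarith [hu.1]
  · rw [← Finset.mul_sum, he, sum_increment_uniformGrid, hκ, div_mul_eq_mul_div,
      div_lt_iff₀ (by positivity)]
    nlinarith

/-- Abel summation. It moves the differences from the Brownian path, which need not have bounded
variation, to the monotone integrand. -/
theorem sum_mul_increment (f w : ℕ → ℝ) (n : ℕ) :
    ∑ i ∈ Finset.range n, f i * (w (i + 1) - w i)
      = f n * w n - f 0 * w 0 - ∑ i ∈ Finset.range n, (f (i + 1) - f i) * w (i + 1) := by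
  induction n with
  | zero => simp
  | succ n ih => rw [Finset.sum_range_succ, Finset.sum_range_succ, ih]; ring

end UniformGrid

/-! ## The Itô integral of a deterministic monotone function -/

section Existence

variable {Ω : Type*} {mΩ : MeasurableSpace Ω} {P : Measure Ω} {ℱ : Filtration ℝ≥0 mΩ}
  {W : ℝ≥0 → Ω → ℝ} {t T : ℝ}

/-- The elementary process that samples a monotone function on the uniform grid. -/
noncomputable def sampledProcess (ℱ : Filtration ℝ≥0 mΩ) (F : StieltjesFunction ℝ) (htT : t ≤ T)
    (k : ℕ) : ElementaryProcess ℱ t T where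
  n := k + 1
  grid := uniformGrid t T k
  coef i _ := F (uniformGrid t T k i)
  grid_mono := uniformGrid_mono htT k
  grid_mem := uniformGrid_mem htT k
  coef_meas _ := measurable_const
  coef_bdd := ⟨max |F t| |F T|, fun i _ => by
    have h := uniformGrid_mem htT k i
    have h1 := F.mono h.1
    have h2 := F.mono h.2
    rw [abs_le]
    constructor
    · linarith [neg_abs_le (F t), le_max_left |F t| |F T|]
    · linarith [le_abs_self (F T), le_max_right |F t| |F T|]⟩

/-- The pathwise value of `∫_t^s F dW`, by integration by parts. -/
noncomputable def wienerPath (F : StieltjesFunction ℝ) (t T : ℝ) (w : ℝ≥0 → ℝ) (s : ℝ) : ℝ :=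
  F T * w s.toNNReal - F t * w t.toNNReal - ∫ u in t..T, w (min u s).toNNReal ∂F.measure

/-- An adapted version of `∫_t^s F dW`. -/
noncomputable def wienerIntegral (ℱ : Filtration ℝ≥0 mΩ) (F : StieltjesFunction ℝ) (htT : t ≤ T)
    (W : ℝ≥0 → Ω → ℝ) (s : ℝ) (ω : Ω) : ℝ :=
  -- Taking the limit of the elementary integrals yields exact measurability with respect to the
  -- sigma-algebra at time `s`, even off the event of continuous paths, so the filtration need not
  -- be complete.
  limUnder atTop fun k => (sampledProcess ℱ F htT k).integral W s ω

/-- After summation by parts, the elementary integral consists of boundary terms minus a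
Riemann–Stieltjes sum of the path stopped at `s`. The stopping lets the grid stay on `[t, T]` for
every `s`. -/
theorem tendsto_sampledProcess_integral (F : StieltjesFunction ℝ) (htT : t ≤ T) {ω : Ω}
    (hω : Continuous (W · ω)) {s : ℝ} (hs : s ∈ Icc t T) :
    Tendsto (fun k => (sampledProcess ℱ F htT k).integral W s ω) atTop
      (𝓝 (wienerPath F t T (W · ω) s)) := by
  have hw : Continuous fun u : ℝ => W (min u s).toNNReal ω :=
    hω.comp (continuous_real_toNNReal.comp (by fun_prop))
  have h := (tendsto_riemannStieltjes_sum F htT hw.continuousOn).const_sub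
    (F T * W s.toNNReal ω - F t * W t.toNNReal ω)
  refine h.congr fun k => ?_
  symm
  simp only [ElementaryProcess.integral, sampledProcess]
  rw [sum_mul_increment (fun i => F (uniformGrid t T k i))
    (fun i => W (min (uniformGrid t T k i) s).toNNReal ω), uniformGrid_last, uniformGrid_zero,
    min_eq_right hs.2, min_eq_left hs.1]

theorem wienerIntegral_eq (F : StieltjesFunction ℝ) (htT : t ≤ T) {ω : Ω}
    (hω : Continuous (W · ω)) {s : ℝ} (hs : s ∈ Icc t T) :
    wienerIntegral ℱ F htT W s ω = wienerPath F t T (W · ω) s :=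
  (tendsto_sampledProcess_integral F htT hω hs).limUnder_eq

theorem continuous_wienerPath (F : StieltjesFunction ℝ) {w : ℝ≥0 → ℝ} (hw : Continuous w) :
    Continuous (wienerPath F t T w) := by
  have hw' : Continuous fun u : ℝ => w u.toNNReal := hw.comp continuous_real_toNNReal
  have h2 : Continuous fun s : ℝ => ∫ u in t..T, w (min u s).toNNReal ∂F.measure := by
    have : Continuous (Function.uncurry fun s u : ℝ => w (min u s).toNNReal) :=
      hw'.comp (continuous_snd.min continuous_fst)
    have h := continuous_parametric_integral_of_continuous
      (μ := F.measure.restrict (uIoc t T)) this (isCompact_uIcc (a := t) (b := T))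
    rw [Measure.restrict_restrict measurableSet_uIcc,
      inter_eq_self_of_subset_right uIoc_subset_uIcc] at h
    simp only [intervalIntegral.intervalIntegral_eq_integral_uIoc]
    exact (continuous_const (y := if t ≤ T then (1 : ℝ) else -1)).smul h
  unfold wienerPath
  fun_prop

theorem abs_wienerPath_le (F : StieltjesFunction ℝ) (ht : 0 ≤ t) (htT : t ≤ T) {w : ℝ≥0 → ℝ}
    {C : ℝ} (hC : ∀ u : ℝ≥0, (u : ℝ) ≤ T → |w u| ≤ C) {s : ℝ} (hs : s ∈ Icc t T) :
    |wienerPath F t T w s| ≤ (|F T| + |F t| + (F T - F t)) * C := by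
  have hT : 0 ≤ T := ht.trans htT
  have hb : ∀ u : ℝ, u ≤ T → |w u.toNNReal| ≤ C := fun u hu =>
    hC _ (by rw [Real.coe_toNNReal']; exact max_le hu hT)
  have h1 : ‖∫ u in t..T, w (min u s).toNNReal ∂F.measure‖ ≤ C * (F T - F t) := by
    rw [intervalIntegral.integral_of_le htT]
    refine (norm_setIntegral_le_of_norm_le_const (by simp [F.measure_Ioc])
      fun u hu => hb _ ((min_le_left _ _).trans hu.2)).trans_eq ?_
    rw [Measure.real, F.measure_Ioc, ENNReal.toReal_ofReal (sub_nonneg.2 (F.mono htT))]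
  rw [Real.norm_eq_abs] at h1
  have h2 : |F T * w s.toNNReal| ≤ |F T| * C := by
    rw [abs_mul]; exact mul_le_mul_of_nonneg_left (hb s hs.2) (abs_nonneg _)
  have h3 : |F t * w t.toNNReal| ≤ |F t| * C := by
    rw [abs_mul]; exact mul_le_mul_of_nonneg_left (hb t htT) (abs_nonneg _)
  unfold wienerPath
  have h4 := abs_sub (F T * w s.toNNReal - F t * w t.toNNReal)
    (∫ u in t..T, w (min u s).toNNReal ∂F.measure)
  have h5 := abs_sub (F T * w s.toNNReal) (F t * w t.toNNReal)
  linarith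

theorem sampledProcess_value (F : StieltjesFunction ℝ) (htT : t ≤ T) {k i : ℕ} (hi : i ≤ k)
    {s : ℝ} (hs : s ∈ Ioc (uniformGrid t T k i) (uniformGrid t T k (i + 1))) (ω : Ω) :
    (sampledProcess ℱ F htT k).value s ω = F (uniformGrid t T k i) := by
  simp only [ElementaryProcess.value, sampledProcess]
  rw [Finset.sum_eq_single_of_mem i (Finset.mem_range.2 (by omega)), indicator_of_mem hs]
  intro j _ hji
  refine indicator_of_notMem (fun hj => ?_) _
  have := (uniformGrid_mono htT k).pairwise_disjoint_on_Ioc_succ hji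
  exact Set.disjoint_left.1 this hj hs

/-- The sampled processes converge to `F` in `L²(dt)`. -/
theorem lintegral_sampledProcess_sub_sq_le (F : StieltjesFunction ℝ) (htT : t ≤ T) (k : ℕ) (ω : Ω) :
    ∫⁻ s in Icc t T, ENNReal.ofReal (((sampledProcess ℱ F htT k).value s ω - F s) ^ 2)
      ≤ ENNReal.ofReal ((F T - F t) ^ 2 * ((T - t) / (k + 1))) := by
  have hmono := uniformGrid_mono htT k
  have hF : 0 ≤ F T - F t := sub_nonneg.2 (F.mono htT)
  have hst : 0 ≤ (T - t) / ((k : ℝ) + 1) := div_nonneg (sub_nonneg.2 htT) (by positivity)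
  have hcover : Ioc t T ⊆ ⋃ i ∈ Finset.range (k + 1),
      Ioc (uniformGrid t T k i) (uniformGrid t T k (i + 1)) := by
    intro s hs
    obtain ⟨i, hi, his⟩ := exists_mem_Ioc_uniformGrid (a := t) (b := T) k hs
    exact mem_iUnion₂.2 ⟨i, Finset.mem_range.2 (by omega), his⟩
  rw [setLIntegral_congr Ioc_ae_eq_Icc.symm]
  refine (lintegral_mono_set hcover).trans ?_
  rw [lintegral_biUnion_finset
    (t := fun i => Ioc (uniformGrid t T k i) (uniformGrid t T k (i + 1))) (fun _i _ _j _ hij => hmono.pairwise_disjoint_on_Ioc_succ hij)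
    (fun _ _ => measurableSet_Ioc)]
  -- One factor of the square is bounded by the total increment of `F`; the other keeps the
  -- increment over the step, which telescopes.
  have hterm : ∀ i ∈ Finset.range (k + 1),
      ∫⁻ s in Ioc (uniformGrid t T k i) (uniformGrid t T k (i + 1)),
        ENNReal.ofReal (((sampledProcess ℱ F htT k).value s ω - F s) ^ 2)
      ≤ ENNReal.ofReal ((F T - F t) * ((T - t) / (k + 1)) *
        (F (uniformGrid t T k (i + 1)) - F (uniformGrid t T k i))) := by
    intro i hi
    set x := uniformGrid t T k i
    set y := uniformGrid t T k (i + 1)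
    have hx : x ∈ Icc t T := uniformGrid_mem htT k i
    have hy : y ∈ Icc t T := uniformGrid_mem htT k (i + 1)
    have hxy : F x ≤ F y := F.mono (hmono (Nat.le_succ i))
    have hFy := F.mono hy.2
    have hFx := F.mono hx.1
    calc _ ≤ ∫⁻ _s in Ioc x y, ENNReal.ofReal ((F T - F t) * (F y - F x)) := by
          refine setLIntegral_mono' measurableSet_Ioc fun s hs => ENNReal.ofReal_le_ofReal ?_
          rw [sampledProcess_value F htT (Nat.lt_succ_iff.1 (Finset.mem_range.1 hi)) hs]
          have h1 := F.mono hs.1.le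
          have h2 := F.mono hs.2
          nlinarith
      _ = ENNReal.ofReal ((F T - F t) * (F y - F x) * (y - x)) := by
          rw [setLIntegral_const, Real.volume_Ioc,
            ENNReal.ofReal_mul (mul_nonneg hF (sub_nonneg.2 hxy))]
      _ ≤ _ := by
          refine ENNReal.ofReal_le_ofReal ?_
          have h1 := uniformGrid_step htT k i
          have h2 : 0 ≤ (F T - F t) * (F y - F x) := mul_nonneg hF (sub_nonneg.2 hxy)
          have := mul_le_mul_of_nonneg_left h1 h2
          linarith
  refine (Finset.sum_le_sum hterm).trans ?_
  rw [← ENNReal.ofReal_sum_of_nonneg fun i _ => mul_nonneg (mul_nonneg hF hst)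
    (sub_nonneg.2 (F.mono (hmono (Nat.le_succ i)))), ← Finset.mul_sum,
    sum_increment_uniformGrid]
  exact ENNReal.ofReal_le_ofReal (le_of_eq (by ring))

theorem measurable_sampledProcess_integral (hW : IsFilteredBrownian ℱ P W)
    (F : StieltjesFunction ℝ) (htT : t ≤ T) (k : ℕ) (s : ℝ) :
    Measurable[ℱ s.toNNReal] ((sampledProcess ℱ F htT k).integral W s) :=
  Finset.measurable_fun_sum _ fun _ _ => measurable_const.mul
    ((hW.measurable (Real.toNNReal_le_toNNReal (min_le_right _ _))).sub
      (hW.measurable (Real.toNNReal_le_toNNReal (min_le_right _ _))))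

theorem measurable_limUnder_nat {m : MeasurableSpace Ω} {u : ℕ → Ω → ℝ}
    (hu : ∀ k, Measurable (u k)) : Measurable fun ω => limUnder atTop fun k => u k ω :=
  (StronglyMeasurable.limUnder (l := atTop) fun k => (hu k).stronglyMeasurable).measurable

theorem measurable_wienerIntegral (hW : IsFilteredBrownian ℱ P W) (F : StieltjesFunction ℝ)
    (htT : t ≤ T) (s : ℝ) : Measurable[ℱ s.toNNReal] (wienerIntegral ℱ F htT W s) :=
  measurable_limUnder_nat fun k => measurable_sampledProcess_integral hW F htT k s

/-- A deterministic function that is monotone and right continuous on `[t, T]` has an Itô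
integral, given pathwise by integration by parts. -/
theorem isItoIntegral_wienerIntegral [IsProbabilityMeasure P] (hW : IsFilteredBrownian ℱ P W)
    (F : StieltjesFunction ℝ) (htT : t ≤ T) {f : ℝ → ℝ} (hf : Measurable f)
    (hfF : EqOn f F (Icc t T)) :
    IsItoIntegral ℱ P W t T (fun s _ => f s) (wienerIntegral ℱ F htT W) where
  integrand_measurable := hf.comp measurable_fst
  integrand_adapted _ _ := measurable_const
  adapted s _ := measurable_wienerIntegral hW F htT s
  continuous := by
    filter_upwards [hW.isBrownian.cont] with ω hω
    exact (continuous_wienerPath (t := t) (T := T) F hω).continuousOn.congr fun s hs =>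
      wienerIntegral_eq F htT hω hs
  approx := by
    refine ⟨sampledProcess ℱ F htT, fun ε hε => ?_, fun s hs => ?_⟩
    · have hlim : Tendsto (fun k : ℕ => ENNReal.ofReal ((F T - F t) ^ 2 * ((T - t) / (k + 1))))
          atTop (𝓝 0) := by
        have := (tendsto_uniformGrid_step (a := t) (b := T)).const_mul ((F T - F t) ^ 2)
        rw [mul_zero] at this
        simpa using ENNReal.tendsto_ofReal this
      -- The `L²` error bound does not depend on `ω`, so the exceptional event is eventually empty.
      refine tendsto_const_nhds.congr' ?_
      filter_upwards [hlim.eventually (gt_mem_nhds hε)] with k hk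
      symm
      refine measure_mono_null (fun ω hω => ?_) measure_empty
      have h1 : ∫⁻ s in Icc t T, ENNReal.ofReal (((sampledProcess ℱ F htT k).value s ω - f s) ^ 2)
          = ∫⁻ s in Icc t T, ENNReal.ofReal (((sampledProcess ℱ F htT k).value s ω - F s) ^ 2) :=
        setLIntegral_congr_fun measurableSet_Icc fun s hs => by simp only [hfF hs]
      simp only [mem_ofPred_eq] at hω
      rw [h1] at hω
      exact absurd ((hω.trans (lintegral_sampledProcess_sub_sq_le F htT k ω)).trans_lt hk)
        (lt_irrefl _)
    · refine tendstoInMeasure_of_tendsto_ae (fun k =>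
        ((measurable_sampledProcess_integral hW F htT k s).mono
          (ℱ.le _) le_rfl).aestronglyMeasurable) ?_
      filter_upwards [hW.isBrownian.cont] with ω hω
      rw [wienerIntegral_eq F htT hω hs]
      exact tendsto_sampledProcess_integral F htT hω hs

end Existence

/-! ## The linear state equation -/

section LinearEquation

variable {r t T : ℝ} {A X : ℝ → ℝ}

theorem intervalIntegrable_of_continuousOn_Icc (hX : ContinuousOn X (Icc t T)) {s : ℝ}
    (hs : s ∈ Icc t T) : IntervalIntegrable X volume t s :=
  (hX.mono (by rw [uIcc_of_le hs.1]; exact Icc_subset_Icc_right hs.2)).intervalIntegrable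

/-- The explicit solution of `X = A + r ∫ X`. -/
noncomputable def linearSolution (r t : ℝ) (A : ℝ → ℝ) (s : ℝ) : ℝ :=
  A s + r * ∫ u in t..s, Real.exp (r * (s - u)) * A u

/-- Variation of constants: `Y` solves Y' = rY + A with Y(t) = 0, the candidate equals A + rY, and
its integral is therefore Y. -/
theorem linearSolution_spec (htT : t ≤ T) (hA : ContinuousOn A (Icc t T)) :
    ContinuousOn (linearSolution r t A) (Icc t T) ∧
    ∀ s ∈ Icc t T, linearSolution r t A s = A s + r * ∫ u in t..s, linearSolution r t A u := by
  -- A continuous extension to the line makes the derivatives two-sided at the endpoints.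
  set B : ℝ → ℝ := IccExtend htT ((Icc t T).domRestrict A) with hB
  have hBc : Continuous B := hA.domRestrict.Icc_extend'
  have hBA : ∀ s ∈ Icc t T, B s = A s := fun s hs => IccExtend_of_mem htT _ hs
  set Y : ℝ → ℝ := fun s => Real.exp (r * s) * ∫ u in t..s, Real.exp (-(r * u)) * B u with hY
  have hYd : ∀ s, HasDerivAt Y (r * Y s + B s) s := by
    intro s
    have h1 : HasDerivAt (fun s => Real.exp (r * s)) (Real.exp (r * s) * r) s := by
      simpa using ((hasDerivAt_id s).const_mul r).exp
    have h2 : HasDerivAt (fun s => ∫ u in t..s, Real.exp (-(r * u)) * B u)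
        (Real.exp (-(r * s)) * B s) s := by
      have hc : Continuous fun u => Real.exp (-(r * u)) * B u := by fun_prop
      exact intervalIntegral.integral_hasDerivAt_right (hc.intervalIntegrable _ _)
        (hc.stronglyMeasurableAtFilter _ _) hc.continuousAt
    refine (h1.mul h2).congr_deriv ?_
    have : Real.exp (r * s) * Real.exp (-(r * s)) = 1 := by
      rw [← Real.exp_add, add_neg_cancel, Real.exp_zero]
    simp only [hY]
    linear_combination B s * this
  have hYc : Continuous Y := continuous_iff_continuousAt.2 fun s => (hYd s).continuousAt
  have hXY : ∀ s ∈ Icc t T, linearSolution r t A s = B s + r * Y s := by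
    intro s hs
    simp only [linearSolution, hY]
    rw [hBA s hs, ← intervalIntegral.integral_const_mul (Real.exp (r * s))]
    congr 2
    refine intervalIntegral.integral_congr fun u hu => ?_
    rw [uIcc_of_le hs.1] at hu
    rw [hBA u ⟨hu.1, hu.2.trans hs.2⟩, mul_sub, sub_eq_add_neg, Real.exp_add, mul_assoc]
  have hcont : ContinuousOn (linearSolution r t A) (Icc t T) :=
    (hBc.add (continuous_const.mul hYc)).continuousOn.congr hXY
  refine ⟨hcont, fun s hs => ?_⟩
  have hint : ∫ u in t..s, linearSolution r t A u = Y s - Y t := by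
    rw [← intervalIntegral.integral_eq_sub_of_hasDerivAt (fun u _ => hYd u)
      (by exact Continuous.intervalIntegrable (by fun_prop) _ _)]
    refine intervalIntegral.integral_congr fun u hu => ?_
    rw [uIcc_of_le hs.1] at hu
    rw [hXY u ⟨hu.1, hu.2.trans hs.2⟩, add_comm]
  have hYt : Y t = 0 := by simp [hY]
  rw [hint, hYt, sub_zero, hXY s hs, hBA s hs]

/-- Grönwall for the primitive z of X: here |z'| ≤ |r| |z| and z(t) = 0. -/
theorem eq_zero_of_eq_integral (htT : t ≤ T) (hX : ContinuousOn X (Icc t T))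
    (h : ∀ s ∈ Icc t T, X s = r * ∫ u in t..s, X u) : ∀ s ∈ Icc t T, X s = 0 := by
  set B : ℝ → ℝ := IccExtend htT ((Icc t T).domRestrict X) with hB
  have hBc : Continuous B := hX.domRestrict.Icc_extend'
  have hBX : ∀ s ∈ Icc t T, B s = X s := fun s hs => IccExtend_of_mem htT _ hs
  have hB' : ∀ s ∈ Icc t T, B s = r * ∫ u in t..s, B u := fun s hs => by
    rw [hBX s hs, h s hs]
    congr 1
    refine intervalIntegral.integral_congr fun u hu => ?_
    rw [uIcc_of_le hs.1] at hu
    exact (hBX u ⟨hu.1, hu.2.trans hs.2⟩).symm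
  have hz : ∀ s ∈ Icc t T, (∫ u in t..s, B u) = 0 := by
    refine eq_zero_of_abs_deriv_le_mul_abs_self_of_eq_zero_right (f' := B) (K := |r|)
      (intervalIntegral.continuous_primitive (fun a b => hBc.intervalIntegrable a b) t).continuousOn
      (fun s _ => (intervalIntegral.integral_hasDerivAt_right (hBc.intervalIntegrable _ _)
        (hBc.stronglyMeasurableAtFilter _ _) hBc.continuousAt).hasDerivWithinAt) (by simp)
      fun s hs => ?_
    rw [hB' s ⟨hs.1, hs.2.le⟩, norm_mul, Real.norm_eq_abs r]
  intro s hs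
  rw [← hBX s hs, hB' s hs, hz s hs, mul_zero]

theorem eq_linearSolution (htT : t ≤ T) (hA : ContinuousOn A (Icc t T))
    (hX : ContinuousOn X (Icc t T)) (h : ∀ s ∈ Icc t T, X s = A s + r * ∫ u in t..s, X u) :
    ∀ s ∈ Icc t T, X s = linearSolution r t A s := by
  obtain ⟨hc, hL⟩ := linearSolution_spec (r := r) htT hA
  have := eq_zero_of_eq_integral (r := r) htT (hX.sub hc) (fun s hs => by
    change X s - linearSolution r t A s = r * ∫ u in t..s, (X u - linearSolution r t A u)
    rw [intervalIntegral.integral_sub (intervalIntegrable_of_continuousOn_Icc hX hs)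
      (intervalIntegrable_of_continuousOn_Icc hc hs)]
    linarith [h s hs, hL s hs])
  exact fun s hs => sub_eq_zero.1 (this s hs)

theorem abs_linearSolution_le (hr : 0 ≤ r) {C : ℝ} (hC : 0 ≤ C)
    (hAC : ∀ s ∈ Icc t T, |A s| ≤ C) {s : ℝ} (hs : s ∈ Icc t T) :
    |linearSolution r t A s| ≤ (1 + r * (Real.exp (r * (T - t)) * (T - t))) * C := by
  have h1 : ‖∫ u in t..s, Real.exp (r * (s - u)) * A u‖
      ≤ Real.exp (r * (T - t)) * C * |s - t| := by
    refine intervalIntegral.norm_integral_le_of_norm_le_const fun u hu => ?_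
    rw [uIoc_of_le hs.1] at hu
    rw [norm_mul, Real.norm_eq_abs, Real.abs_exp]
    refine mul_le_mul (Real.exp_le_exp.2 (mul_le_mul_of_nonneg_left ?_ hr))
      (hAC u ⟨hu.1.le, hu.2.trans hs.2⟩) (norm_nonneg _) (Real.exp_nonneg _)
    linarith [hu.1, hs.2]
  rw [abs_of_nonneg (sub_nonneg.2 hs.1), Real.norm_eq_abs] at h1
  have h2 : Real.exp (r * (T - t)) * C * (s - t) ≤ Real.exp (r * (T - t)) * C * (T - t) :=
    mul_le_mul_of_nonneg_left (sub_le_sub_right hs.2 t) (by positivity)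
  unfold linearSolution
  have h3 := abs_add_le (A s) (r * ∫ u in t..s, Real.exp (r * (s - u)) * A u)
  rw [abs_mul, abs_of_nonneg hr] at h3
  have h4 := mul_le_mul_of_nonneg_left (h1.trans h2) hr
  have h5 := hAC s hs
  nlinarith

end LinearEquation

/-! ### The surplus under a deterministic control -/

section Surplus

variable {Ω : Type*} {mΩ : MeasurableSpace Ω} {P : Measure Ω} {ℱ : Filtration ℝ≥0 mΩ}
  {W : ℝ≥0 → Ω → ℝ} {M : InvestmentModel} {t x τ : ℝ} {f : ℝ → ℝ}

namespace InvestmentModel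

/-- The part of the drift of the surplus that does not depend on the state. -/
noncomputable def freeDrift (M : InvestmentModel) (f : ℝ → ℝ) (τ u : ℝ) : ℝ :=
  M.μ * f u - M.δ - (Ici τ).indicator (fun _ => M.ρ) u

/-- The surplus without the interest earned on it. -/
noncomputable def forcing (M : InvestmentModel) (f : ℝ → ℝ) (τ t x : ℝ) (I : ℝ → ℝ) (s : ℝ) : ℝ :=
  x + (∫ u in t..s, M.freeDrift f τ u) + M.σ * I s

theorem intervalIntegrable_freeDrift {a b : ℝ} (hf : IntervalIntegrable f volume a b) :
    IntervalIntegrable (M.freeDrift f τ) volume a b := by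
  refine ((hf.const_mul _).sub intervalIntegrable_const).sub ?_
  rw [intervalIntegrable_iff]
  exact IntegrableOn.indicator (by simp) measurableSet_Ici

theorem continuousOn_forcing {I : ℝ → ℝ} (htT : t ≤ M.T) (hf : IntervalIntegrable f volume t M.T)
    (hI : ContinuousOn I (Icc t M.T)) : ContinuousOn (M.forcing f τ t x I) (Icc t M.T) := by
  have h : ContinuousOn (fun s => ∫ u in t..s, M.freeDrift f τ u) (Icc t M.T) := by
    have := intervalIntegral.continuousOn_primitive_interval (μ := volume)
      ((intervalIntegrable_iff_integrableOn_Icc_of_le htT).1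
        (intervalIntegrable_freeDrift (M := M) (τ := τ) hf) |>.mono_set (uIcc_of_le htT).subset)
    rwa [uIcc_of_le htT] at this
  exact (continuousOn_const.add h).add (continuousOn_const.mul hI)

theorem forcing_add_integral {I X : ℝ → ℝ} {s : ℝ} (hf : IntervalIntegrable f volume t s)
    (hX : IntervalIntegrable X volume t s) :
    x + (∫ u in t..s, (M.r * X u + M.μ * f u - M.δ - (Ici τ).indicator (fun _ => M.ρ) u))
      + M.σ * I s = M.forcing f τ t x I s + M.r * ∫ u in t..s, X u := by
  have : ∫ u in t..s, (M.r * X u + M.μ * f u - M.δ - (Ici τ).indicator (fun _ => M.ρ) u)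
      = (M.r * ∫ u in t..s, X u) + ∫ u in t..s, M.freeDrift f τ u := by
    rw [← intervalIntegral.integral_const_mul, ← intervalIntegral.integral_add (hX.const_mul _)
      (intervalIntegrable_freeDrift hf)]
    congr 1
    ext u
    unfold freeDrift
    ring
  rw [this, forcing]
  ring

/-- With a deterministic control, every surplus process is the explicit solution of the linear
state equation driven by the Itô integral of the control. -/
theorem IsSurplus.ae_eq_linearSolution [IsProbabilityMeasure P] (hW : IsFilteredBrownian ℱ P W)
    (ht : t ∈ Icc 0 M.T) {X I : ℝ → Ω → ℝ} (hI : IsItoIntegral ℱ P W t M.T (fun s _ => f s) I)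
    (hX : M.IsSurplus ℱ P W t x (fun _ => τ) (fun s _ => f s) X) :
    ∀ᵐ ω ∂P, ∀ s ∈ Icc t M.T,
      X s ω = linearSolution M.r t (M.forcing f τ t x (I · ω)) s := by
  obtain ⟨J, hJ, hJX⟩ := hX.equation
  filter_upwards [hJ.indistinguishable hW ht.1 hI, hI.continuous, hX.continuous, hJX,
    hX.control_integrable] with ω h1 h2 h3 h4 h5
  refine eq_linearSolution ht.2 (continuousOn_forcing ht.2 h5 h2) h3 fun s hs => ?_
  rw [h4 s hs, h1 s hs]
  exact forcing_add_integral (M := M) (x := x) (τ := τ) (I := (I · ω)) (h5.mono_set (uIcc_subset_uIcc_left (by rwa [uIcc_of_le ht.2])))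
    (intervalIntegrable_of_continuousOn_Icc h3 hs)

/-- An adapted version of the explicit surplus process. -/
noncomputable def explicitSurplus (M : InvestmentModel) (f : ℝ → ℝ) (τ t x : ℝ)
    (I : ℝ → Ω → ℝ) (s : ℝ) (ω : Ω) : ℝ :=
  -- The integral in `linearSolution` is replaced by a limit of Riemann sums on `[t, s]`, which
  -- sample the forcing only up to time `s` and so keep the process adapted for every `ω`.
  M.forcing f τ t x (I · ω) s + M.r * limUnder atTop fun k : ℕ => ∑ i ∈ Finset.range (k + 1),
    (uniformGrid t s k (i + 1) - uniformGrid t s k i) *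
      (Real.exp (M.r * (s - uniformGrid t s k (i + 1)))
        * M.forcing f τ t x (I · ω) (uniformGrid t s k (i + 1)))

theorem isSurplus_explicitSurplus (ht : t ∈ Icc 0 M.T) (hf : IntervalIntegrable f volume t M.T)
    {I : ℝ → Ω → ℝ} (hI : IsItoIntegral ℱ P W t M.T (fun s _ => f s) I) :
    M.IsSurplus ℱ P W t x (fun _ => τ) (fun s _ => f s) (M.explicitSurplus f τ t x I) := by
  have hfm : ∀ u ∈ Icc t M.T, Measurable[ℱ u.toNNReal] fun ω => M.forcing f τ t x (I · ω) u :=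
    fun u hu => measurable_const.add (measurable_const.mul (hI.adapted u hu))
  have heq : ∀ᵐ ω ∂P, ∀ s ∈ Icc t M.T, M.explicitSurplus f τ t x I s ω
      = linearSolution M.r t (M.forcing f τ t x (I · ω)) s := by
    filter_upwards [hI.continuous] with ω hω s hs
    have hc := continuousOn_forcing (M := M) (x := x) (τ := τ) ht.2 hf hω
    have h1 : ContinuousOn (fun u => Real.exp (M.r * (s - u)) * M.forcing f τ t x (I · ω) u)
        (Icc t s) :=
      ContinuousOn.mul (by fun_prop) (hc.mono (Icc_subset_Icc_right hs.2))
    -- Lebesgue measure is the Stieltjes measure of the identity, so the same convergence result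
    -- serves here.
    have h2 := tendsto_riemannStieltjes_sum StieltjesFunction.id hs.1 h1
    rw [← Real.volume_eq_stieltjes_id] at h2
    unfold explicitSurplus linearSolution
    rw [← h2.limUnder_eq]
    rfl
  refine ⟨fun s hs => ?_, ?_, ae_of_all _ fun _ => hf, I, hI, ?_⟩
  · refine (hfm s hs).add (measurable_const.mul (measurable_limUnder_nat fun k =>
      Finset.measurable_fun_sum _ fun i _ => measurable_const.mul (measurable_const.mul ?_)))
    have hg := uniformGrid_mem hs.1 k (i + 1)
    exact (hfm _ ⟨hg.1, hg.2.trans hs.2⟩).mono (ℱ.mono (Real.toNNReal_le_toNNReal hg.2)) le_rfl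
  · filter_upwards [heq, hI.continuous] with ω h1 h2
    exact (linearSolution_spec ht.2 (continuousOn_forcing ht.2 hf h2)).1.congr h1
  · filter_upwards [heq, hI.continuous] with ω h1 h2 s hs
    obtain ⟨hc, hL⟩ := linearSolution_spec (r := M.r) ht.2
      (continuousOn_forcing (M := M) (x := x) (τ := τ) ht.2 hf h2)
    have hc' : ContinuousOn (fun u => M.explicitSurplus f τ t x I u ω) (Icc t M.T) := hc.congr h1
    rw [forcing_add_integral (I := (I · ω)) (X := fun u => M.explicitSurplus f τ t x I u ω)
      (hf.mono_set (uIcc_subset_uIcc_left (by rwa [uIcc_of_le ht.2])))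
      (intervalIntegrable_of_continuousOn_Icc hc' hs), h1 s hs, hL s hs]
    congr 2
    refine intervalIntegral.integral_congr fun u hu => ?_
    rw [uIcc_of_le hs.1] at hu
    exact (h1 u ⟨hu.1, hu.2.trans hs.2⟩).symm

/-- With a monotone control, the surplus grows at most linearly with the running maximum of the
Brownian path. -/
theorem IsSurplus.exists_abs_le [IsProbabilityMeasure P] (hW : IsFilteredBrownian ℱ P W)
    (hr : 0 ≤ M.r) (ht : t ∈ Icc 0 M.T) (F : StieltjesFunction ℝ) (hfm : Measurable f)
    (hfF : EqOn f F (Icc t M.T)) (hf : IntervalIntegrable f volume t M.T) {X : ℝ → Ω → ℝ}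
    (hX : M.IsSurplus ℱ P W t x (fun _ => τ) (fun s _ => f s) X) :
    ∃ C, 0 ≤ C ∧ ∀ᵐ ω ∂P, ∀ R, (∀ u : ℝ≥0, (u : ℝ) ≤ M.T → |W u ω| ≤ R) →
      ∀ s ∈ Icc t M.T, |X s ω| ≤ C * (1 + R) := by
  have hT : 0 ≤ M.T := ht.1.trans ht.2
  have hI := isItoIntegral_wienerIntegral hW F ht.2 hfm hfF
  -- `K₁` bounds the deterministic part of the forcing, `K₂` the coefficient of the bound `R` on the
  -- Brownian path.
  set K₁ := |x| + ∫ u in t..M.T, |M.freeDrift f τ u| with hK₁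
  set K₂ := |M.σ| * (|F M.T| + |F t| + (F M.T - F t)) with hK₂
  have hK₁0 : 0 ≤ K₁ := add_nonneg (abs_nonneg _)
    (intervalIntegral.integral_nonneg ht.2 fun _ _ => abs_nonneg _)
  have hK₂0 : 0 ≤ K₂ := by
    have := sub_nonneg.2 (F.mono ht.2)
    positivity
  have hE : 0 ≤ 1 + M.r * (Real.exp (M.r * (M.T - t)) * (M.T - t)) := by
    have := sub_nonneg.2 ht.2
    positivity
  refine ⟨(1 + M.r * (Real.exp (M.r * (M.T - t)) * (M.T - t))) * (K₁ + K₂), by positivity, ?_⟩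
  filter_upwards [hX.ae_eq_linearSolution hW ht hI, hW.isBrownian.cont] with ω h1 h2 R hR s hs
  have hR0 : 0 ≤ R := (abs_nonneg _).trans (hR 0 (by simpa using hT))
  rw [h1 s hs, mul_assoc]
  refine (abs_linearSolution_le (C := K₁ + K₂ * R) hr (by positivity) (fun u hu => ?_) hs).trans
    (mul_le_mul_of_nonneg_left ?_ hE)
  · unfold forcing
    have hb := intervalIntegrable_freeDrift (M := M) (τ := τ) hf
    have e1 : |∫ v in t..u, M.freeDrift f τ v| ≤ ∫ v in t..M.T, |M.freeDrift f τ v| := by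
      refine (intervalIntegral.abs_integral_le_integral_abs hu.1).trans ?_
      exact intervalIntegral.integral_mono_interval le_rfl hu.1 hu.2
        (ae_of_all _ fun _ => abs_nonneg _) hb.abs
    have e2 : |M.σ * wienerIntegral ℱ F ht.2 W u ω| ≤ K₂ * R := by
      rw [abs_mul, wienerIntegral_eq F ht.2 h2 hu, hK₂, mul_assoc]
      exact mul_le_mul_of_nonneg_left (abs_wienerPath_le F ht.1 ht.2 hR hu) (abs_nonneg _)
    have e3 := abs_add_le (x + ∫ v in t..u, M.freeDrift f τ v)
      (M.σ * wienerIntegral ℱ F ht.2 W u ω)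
    have e4 := abs_add_le x (∫ v in t..u, M.freeDrift f τ v)
    linarith
  · nlinarith

end InvestmentModel

end Surplus

/-! ## Exponential moments of the running maximum of Brownian motion -/

section RunningMaximum

variable {Ω : Type*} {mΩ : MeasurableSpace Ω} {P : Measure Ω} {ℱ : Filtration ℝ≥0 mΩ}
  {W : ℝ≥0 → Ω → ℝ} {T : ℝ}

theorem ProbabilityTheory.HasLaw.integrable_exp_mul {X : Ω → ℝ} {a : ℝ} {v : ℝ≥0}
    (hX : HasLaw X (gaussianReal a v) P) (c : ℝ) : Integrable (fun ω => Real.exp (c * X ω)) P := by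
  have h := integrable_exp_mul_gaussianReal (μ := a) (v := v) c
  rw [← hX.map_eq] at h
  exact h.comp_aemeasurable hX.aemeasurable

theorem ProbabilityTheory.HasLaw.integral_exp_mul {X : Ω → ℝ} {v : ℝ≥0}
    (hX : HasLaw X (gaussianReal 0 v) P) (c : ℝ) :
    ∫ ω, Real.exp (c * X ω) ∂P = Real.exp (v * c ^ 2 / 2) := by
  have := mgf_gaussianReal hX.map_eq c
  rwa [zero_mul, zero_add] at this

/-- The filtration of a process observed along a nondecreasing sequence of times. -/
def sampledFiltration (ℱ : Filtration ℝ≥0 mΩ) {e : ℕ → ℝ≥0} (he : Monotone e) :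
    Filtration ℕ mΩ where
  seq j := ℱ (e j)
  mono' _ _ hij := ℱ.mono (he hij)
  le' _ := ℱ.le _

variable [IsProbabilityMeasure P]

/-- The next value is the current one times an independent factor of mean e^{c²Δt/2} ≥ 1. -/
theorem IsFilteredBrownian.submartingale_exp (hW : IsFilteredBrownian ℱ P W) {e : ℕ → ℝ≥0}
    (he : Monotone e) (c : ℝ) :
    Submartingale (fun j ω => Real.exp (c * W (e j) ω)) (sampledFiltration ℱ he) P := by
  have hint : ∀ u, Integrable (fun ω => Real.exp (c * W u ω)) P := fun u =>
    (hW.isBrownian.hasLaw_eval u).integrable_exp_mul c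
  have hmeas : ∀ j, StronglyMeasurable[ℱ (e j)] (fun ω => Real.exp (c * W (e j) ω)) := fun j =>
    (Real.measurable_exp.comp ((hW.adapted (e j)).const_mul c)).stronglyMeasurable
  refine submartingale_nat hmeas (fun j => hint _) fun j => ?_
  set Δ : Ω → ℝ := fun ω => W (e (j + 1)) ω - W (e j) ω with hΔ
  have hlaw := hW.hasLaw_increment (e j) (e (j + 1))
  have hprod : (fun ω => Real.exp (c * W (e (j + 1)) ω))
      = (fun ω => Real.exp (c * W (e j) ω)) * fun ω => Real.exp (c * Δ ω) := by
    ext ω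
    simp only [Pi.mul_apply, hΔ]
    rw [← Real.exp_add]
    congr 1; ring
  have hΔm : Measurable Δ :=
    ((hW.adapted _).mono (ℱ.le _) le_rfl).sub ((hW.adapted _).mono (ℱ.le _) le_rfl)
  have h1 : P[fun ω => Real.exp (c * W (e (j + 1)) ω) | ℱ (e j)] =ᵐ[P]
      (fun ω => Real.exp (c * W (e j) ω)) * P[fun ω => Real.exp (c * Δ ω) | ℱ (e j)] := by
    have hi := hint (e (j + 1))
    rw [hprod] at hi ⊢
    exact condExp_mul_of_stronglyMeasurable_left (hmeas j) hi (hlaw.integrable_exp_mul c)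
  have h2 : P[fun ω => Real.exp (c * Δ ω) | ℱ (e j)] =ᵐ[P]
      fun _ => ∫ ω, Real.exp (c * Δ ω) ∂P := by
    refine condExp_indep_eq (m₁ := MeasurableSpace.comap Δ inferInstance) hΔm.comap_le (ℱ.le _)
      ?_ (hW.indep _ _ (he (Nat.le_succ j)))
    exact (Real.measurable_exp.comp
      ((comap_measurable Δ).const_mul c)).stronglyMeasurable
  change _ ≤ᵐ[P] P[fun ω => Real.exp (c * W (e (j + 1)) ω) | ℱ (e j)]
  filter_upwards [h1, h2] with ω h1 h2
  rw [h1, Pi.mul_apply, h2, hlaw.integral_exp_mul c]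
  exact le_mul_of_one_le_right (Real.exp_nonneg _) (Real.one_le_exp (by positivity))

/-- A weak-type bound for `N` bounds the expectation of `√N`. -/
theorem lintegral_sqrt_le {N : Ω → ℝ} (hN : AEMeasurable N P) {K : ℝ≥0∞}
    (hK : ∀ ε : ℝ≥0, (ε : ℝ≥0∞) * P {ω | (ε : ℝ) ≤ N ω} ≤ K) :
    ∫⁻ ω, ENNReal.ofReal (√(N ω)) ∂P
      ≤ 1 + K * ∫⁻ s in Ioi (1 : ℝ), ENNReal.ofReal (s ^ (-2 : ℝ)) := by
  -- Layer-cake formula: the tail of √N is at most 1 on (0, 1] and at most K s⁻² beyond 1.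
  rw [lintegral_eq_lintegral_meas_le P (ae_of_all _ fun ω => Real.sqrt_nonneg _) hN.sqrt,
    ← Ioc_union_Ioi_eq_Ioi (zero_le_one (α := ℝ)),
    lintegral_union measurableSet_Ioi (Set.disjoint_left.2 fun s h1 h2 => not_lt.2 h1.2 h2),
    ← lintegral_const_mul _ (by fun_prop)]
  refine add_le_add ?_ (setLIntegral_mono' measurableSet_Ioi fun s hs => ?_)
  · refine (setLIntegral_mono' measurableSet_Ioc fun s _ => prob_le_one).trans ?_
    simp
  · have hs0 : (0 : ℝ) < s := one_pos.trans hs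
    have h := hK (s ^ 2).toNNReal
    rw [Real.coe_toNNReal _ (sq_nonneg s)] at h
    have e1 : {ω | s ≤ √(N ω)} = {ω | s ^ 2 ≤ N ω} := by
      ext ω
      exact Real.le_sqrt' hs0
    have e2 : ENNReal.ofReal (s ^ (-2 : ℝ)) = (ENNReal.ofReal (s ^ 2))⁻¹ := by
      rw [Real.rpow_neg hs0.le, ENNReal.ofReal_inv_of_pos (by positivity)]
      norm_num
    rw [e1, e2, ← div_eq_mul_inv, ENNReal.le_div_iff_mul_le
      (Or.inl (ENNReal.ofReal_pos.2 (by positivity)).ne') (Or.inl ENNReal.ofReal_ne_top), mul_comm]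
    exact h

/-- The exponential of Brownian motion is bounded on `[0, T]` by an integrable variable. -/
theorem IsFilteredBrownian.exists_lintegral_lt_top (hW : IsFilteredBrownian ℱ P W) (hT : 0 ≤ T)
    (c : ℝ) : ∃ Z : Ω → ℝ≥0∞, Measurable Z ∧ ∫⁻ ω, Z ω ∂P < ⊤ ∧
      ∀ᵐ ω ∂P, ∀ u : ℝ≥0, (u : ℝ) ≤ T → ENNReal.ofReal (Real.exp (c * W u ω)) ≤ Z ω := by
  set e : ℕ → ℕ → ℝ≥0 := fun k i => (uniformGrid 0 T k i).toNNReal with he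
  have hemono : ∀ k, Monotone (e k) := fun k _ _ hij =>
    Real.toNNReal_le_toNNReal (uniformGrid_mono hT k hij)
  have helast : ∀ k, (e k (k + 1) : ℝ) = T := fun k => by
    simp only [he]
    rw [uniformGrid_last, Real.coe_toNNReal _ hT]
  -- Doob's inequality is applied on finite grids with exponent `2 * c`. Being of weak type, it
  -- controls only the square root of the maximum, and that square root dominates e^{cW} on the
  -- grid.
  set N : ℕ → Ω → ℝ := fun k ω => (Finset.range (k + 1 + 1)).sup' Finset.nonempty_range_add_one
    fun i => Real.exp (2 * c * W (e k i) ω) with hN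
  have hWm : ∀ u, Measurable (W u) := fun u => (hW.adapted u).mono (ℱ.le _) le_rfl
  have hNm : ∀ k, Measurable (N k) := fun k => by
    have := Finset.measurable_sup' (s := Finset.range (k + 1 + 1)) Finset.nonempty_range_add_one
      (f := fun i ω => Real.exp (2 * c * W (e k i) ω))
      fun i _ => Real.measurable_exp.comp ((hWm _).const_mul _)
    convert this using 1
    ext ω
    simp only [hN, Finset.sup'_apply]
  set K : ℝ≥0∞ := ENNReal.ofReal (Real.exp (T * (2 * c) ^ 2 / 2)) with hK
  have hbound : ∀ k, ∀ ε : ℝ≥0, (ε : ℝ≥0∞) * P {ω | (ε : ℝ) ≤ N k ω} ≤ K := by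
    intro k ε
    refine (maximal_ineq (hW.submartingale_exp (hemono k) (2 * c))
      (fun _ _ => Real.exp_nonneg _) (k + 1)).trans (ENNReal.ofReal_le_ofReal ?_)
    refine (setIntegral_le_integral ((hW.isBrownian.hasLaw_eval _).integrable_exp_mul _)
      (ae_of_all _ fun _ => Real.exp_nonneg _)).trans_eq ?_
    rw [(hW.isBrownian.hasLaw_eval _).integral_exp_mul, helast]
  have hfin : 1 + K * ∫⁻ s in Ioi (1 : ℝ), ENNReal.ofReal (s ^ (-2 : ℝ)) < ⊤ := by
    refine ENNReal.add_lt_top.2 ⟨ENNReal.one_lt_top, ENNReal.mul_lt_top ENNReal.ofReal_lt_top ?_⟩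
    exact (integrableOn_Ioi_rpow_of_lt (by norm_num : (-2 : ℝ) < -1) one_pos).lintegral_lt_top
  have hm : ∀ k, Measurable fun ω => ENNReal.ofReal (√(N k ω)) := fun k =>
    (hNm k).sqrt.ennreal_ofReal
  -- By Fatou the lower limit over the grids inherits their uniform bound. It dominates every time
  -- `u`, since `u` is a limit of grid points and the path is continuous.
  refine ⟨fun ω => liminf (fun k => ENNReal.ofReal (√(N k ω))) atTop, Measurable.liminf hm, ?_, ?_⟩
  · refine (lintegral_liminf_le hm).trans_lt (lt_of_le_of_lt ?_ hfin)
    exact liminf_le_of_le (by isBoundedDefault) fun b hb => by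
      obtain ⟨k, hk⟩ := hb.exists
      exact hk.trans (lintegral_sqrt_le (hNm k).aemeasurable (hbound k))
  · filter_upwards [hW.isBrownian.cont] with ω hω u hu
    choose i hi hiu using fun k => exists_abs_uniformGrid_sub_le hT k (s := (u : ℝ)) ⟨u.2, hu⟩
    have h1 : Tendsto (fun k => uniformGrid 0 T k (i k)) atTop (𝓝 (u : ℝ)) := by
      rw [tendsto_iff_dist_tendsto_zero]
      exact squeeze_zero (fun _ => dist_nonneg) hiu tendsto_uniformGrid_step
    have h2 : Tendsto (fun k => e k (i k)) atTop (𝓝 u) := by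
      have := (continuous_real_toNNReal.tendsto (u : ℝ)).comp h1
      rwa [Real.toNNReal_coe] at this
    have h3 : Tendsto (fun k => ENNReal.ofReal (Real.exp (c * W (e k (i k)) ω))) atTop
        (𝓝 (ENNReal.ofReal (Real.exp (c * W u ω)))) :=
      ENNReal.tendsto_ofReal ((Real.continuous_exp.tendsto _).comp
        (((hω.tendsto u).comp h2).const_mul c))
    rw [← h3.liminf_eq]
    refine liminf_le_liminf (Eventually.of_forall fun k => ENNReal.ofReal_le_ofReal ?_)
    refine Real.le_sqrt_of_sq_le ?_
    rw [← Real.exp_nat_mul]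
    refine le_of_eq_of_le ?_ (Finset.le_sup' (fun i => Real.exp (2 * c * W (e k i) ω))
      (Finset.mem_range.2 (Nat.lt_succ_iff.2 (hi k))))
    congr 1
    push_cast; ring

/-- The running maximum of `|W|` on `[0, T]` is bounded by a variable with a finite exponential
moment. -/
theorem IsFilteredBrownian.exists_running_bound (hW : IsFilteredBrownian ℱ P W) (hT : 0 ≤ T)
    {c : ℝ} (hc : 0 < c) : ∃ R : Ω → ℝ, ∫⁻ ω, ENNReal.ofReal (Real.exp (c * R ω)) ∂P < ⊤ ∧
      ∀ᵐ ω ∂P, ∀ u : ℝ≥0, (u : ℝ) ≤ T → |W u ω| ≤ R ω := by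
  -- The exponents `c` and `-c` together control e^{c|W|} by `Y + Z`; the bound on |W| is then log(Y
  -- + Z)/c.
  obtain ⟨Y, hYm, hY, hYW⟩ := hW.exists_lintegral_lt_top hT c
  obtain ⟨Z, hZm, hZ, hZW⟩ := hW.exists_lintegral_lt_top hT (-c)
  have hYf := ae_lt_top hYm hY.ne
  have hZf := ae_lt_top hZm hZ.ne
  have hexp : ∀ᵐ ω ∂P, 0 < (Y ω + Z ω).toReal := by
    filter_upwards [hYf, hZf, hYW] with ω h1 h2 h3
    refine ENNReal.toReal_pos ?_ (ENNReal.add_lt_top.2 ⟨h1, h2⟩).ne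
    have := h3 0 (by simpa using hT)
    exact ((ENNReal.ofReal_pos.2 (Real.exp_pos _)).trans_le
      (this.trans le_self_add)).ne'
  refine ⟨fun ω => Real.log (Y ω + Z ω).toReal / c, ?_, ?_⟩
  · have : ∫⁻ ω, ENNReal.ofReal (Real.exp (c * (Real.log (Y ω + Z ω).toReal / c))) ∂P
        ≤ ∫⁻ ω, (Y ω + Z ω) ∂P := by
      refine lintegral_mono_ae ?_
      filter_upwards [hexp] with ω h
      rw [mul_div_cancel₀ _ hc.ne', Real.exp_log h]
      exact ENNReal.ofReal_toReal_le
    refine this.trans_lt ?_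
    rw [lintegral_add_left hYm]
    exact ENNReal.add_lt_top.2 ⟨hY, hZ⟩
  · filter_upwards [hYf, hZf, hYW, hZW, hexp] with ω h1 h2 h3 h4 h5 u hu
    have hne : Y ω + Z ω ≠ ⊤ := (ENNReal.add_lt_top.2 ⟨h1, h2⟩).ne
    have key : ∀ y : ℝ, ENNReal.ofReal (Real.exp y) ≤ Y ω + Z ω →
        y ≤ Real.log (Y ω + Z ω).toReal := fun y hy => by
      rw [Real.le_log_iff_exp_le h5]
      exact (ENNReal.ofReal_le_iff_le_toReal hne).1 hy
    rw [le_div_iff₀ hc, mul_comm]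
    rcases abs_cases (W u ω) with ⟨h, -⟩ | ⟨h, -⟩ <;> rw [h]
    · exact key _ ((h3 u hu).trans le_self_add)
    · refine key _ (le_of_eq_of_le ?_ ((h4 u hu).trans le_add_self))
      congr 2; ring

end RunningMaximum

/-! ### Exponential moments of the surplus -/

section SurplusMoments

variable {Ω : Type*} {mΩ : MeasurableSpace Ω} {P : Measure Ω} [IsProbabilityMeasure P]
  {ℱ : Filtration ℝ≥0 mΩ} {W : ℝ≥0 → Ω → ℝ} {M : InvestmentModel} {t x τ : ℝ} {f : ℝ → ℝ}

/-- With a monotone control, the running maximum of the surplus has exponential moments. -/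
theorem InvestmentModel.IsSurplus.exists_exp_bound (hW : IsFilteredBrownian ℱ P W)
    (hr : 0 ≤ M.r) (ht : t ∈ Icc 0 M.T) (F : StieltjesFunction ℝ) (hfm : Measurable f)
    (hfF : EqOn f F (Icc t M.T)) (hf : IntervalIntegrable f volume t M.T) {X : ℝ → Ω → ℝ}
    (hX : M.IsSurplus ℱ P W t x (fun _ => τ) (fun s _ => f s) X) {c : ℝ} (hc : 0 ≤ c) :
    ∃ Z : Ω → ℝ≥0∞, ∫⁻ ω, Z ω ∂P < ⊤ ∧
      ∀ᵐ ω ∂P, ∀ s ∈ Icc t M.T, ENNReal.ofReal (Real.exp (c * |X s ω|)) ≤ Z ω := by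
  have hT : 0 ≤ M.T := ht.1.trans ht.2
  obtain ⟨C, hC, hXC⟩ := hX.exists_abs_le hW hr ht F hfm hfF hf
  have hcC : 0 ≤ c * C := mul_nonneg hc hC
  -- The added 1 makes the exponent positive even when `c * C` is zero; it only enlarges the bound
  -- because `R` is nonnegative almost surely.
  obtain ⟨R, hR, hWR⟩ := hW.exists_running_bound hT (c := c * C + 1) (by positivity)
  refine ⟨fun ω => ENNReal.ofReal (Real.exp (c * C)) *
    ENNReal.ofReal (Real.exp ((c * C + 1) * R ω)), ?_, ?_⟩
  · rw [lintegral_const_mul' _ _ ENNReal.ofReal_ne_top]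
    exact ENNReal.mul_lt_top ENNReal.ofReal_lt_top hR
  · filter_upwards [hXC, hWR] with ω h1 h2 s hs
    have hR0 : 0 ≤ R ω := (abs_nonneg _).trans (h2 0 (by simpa using hT))
    rw [← ENNReal.ofReal_mul (Real.exp_nonneg _), ← Real.exp_add]
    refine ENNReal.ofReal_le_ofReal (Real.exp_le_exp.2 ?_)
    have := mul_le_mul_of_nonneg_left (h1 (R ω) h2 s hs) hc
    nlinarith

end SurplusMoments

/-! ## Functions of exponential form -/

/-! ### Classical derivatives as weak derivatives -/

section WeakDerivatives

theorem integral_mul_fderiv_eq_neg {w φ : ℝ × ℝ → ℝ} (hw : ContDiff ℝ 1 w) (hφ : ContDiff ℝ 1 φ)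
    (hc : HasCompactSupport φ) (e : ℝ × ℝ) :
    ∫ z, w z * fderiv ℝ φ z e = -∫ z, fderiv ℝ w z e * φ z := by
  have h1 : Continuous fun z => fderiv ℝ w z e :=
    (hw.continuous_fderiv (by norm_num)).clm_apply continuous_const
  have h2 : Continuous fun z => fderiv ℝ φ z e :=
    (hφ.continuous_fderiv (by norm_num)).clm_apply continuous_const
  refine integral_mul_fderiv_eq_neg_fderiv_mul_of_integrable ?_ ?_ ?_
    (fun z _ => hw.differentiable (by norm_num) z) (fun z _ => hφ.differentiable (by norm_num) z)
  · exact (h1.mul hφ.continuous).integrable_of_hasCompactSupport hc.mul_left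
  · exact (hw.continuous.mul h2).integrable_of_hasCompactSupport (hc.fderiv_apply ℝ e).mul_left
  · exact (hw.continuous.mul hφ.continuous).integrable_of_hasCompactSupport hc.mul_left

namespace InvestmentModel

variable {M : InvestmentModel}

/-- A function that agrees on `[0, T] × ℝ` with a `C¹` function whose space derivative is `C¹` has
the classical derivatives as weak derivatives. -/
theorem hasWeakPartials_of_contDiff {v vt vx vxx : ℝ → ℝ → ℝ} {w wx : ℝ × ℝ → ℝ}
    (hw : ContDiff ℝ 1 w) (hwx : ContDiff ℝ 1 wx)
    (hv : ∀ z : ℝ × ℝ, z.1 ∈ Icc 0 M.T → v z.1 z.2 = w z)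
    (hvt : ∀ z : ℝ × ℝ, z.1 ∈ Icc 0 M.T → vt z.1 z.2 = fderiv ℝ w z (1, 0))
    (hvx : ∀ z : ℝ × ℝ, z.1 ∈ Icc 0 M.T → vx z.1 z.2 = wx z)
    (hwx' : ∀ z, fderiv ℝ w z (0, 1) = wx z)
    (hvxx : ∀ z : ℝ × ℝ, z.1 ∈ Icc 0 M.T → vxx z.1 z.2 = fderiv ℝ wx z (0, 1)) :
    M.HasWeakPartials v vt vx vxx := by
  intro φ hφ hc hsupp
  have hφ1 : ContDiff ℝ 1 φ := hφ.of_le (by exact_mod_cast le_top)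
  set ψ : ℝ × ℝ → ℝ := fun z => fderiv ℝ φ z (0, 1) with hψ
  have hψ1 : ContDiff ℝ 1 ψ :=
    (hφ.fderiv_right (m := 1) (by norm_cast)).clm_apply contDiff_const
  have hψc : HasCompactSupport ψ := hc.fderiv_apply ℝ (0, 1)
  have hψsupp : tsupport ψ ⊆ tsupport φ := tsupport_fderiv_apply_subset ℝ (0, 1)
  -- The test function is supported where the time lies in (0, T), so `v` and its derivatives may be
  -- replaced under the integral by globally defined functions.
  have hcongr : ∀ {a b c : ℝ × ℝ → ℝ}, (∀ z : ℝ × ℝ, z.1 ∈ Icc 0 M.T → a z = b z) →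
      (∀ z ∉ tsupport φ, c z = 0) → ∫ z, a z * c z = ∫ z, b z * c z := by
    intro a b c hab hc
    congr 1
    ext z
    by_cases hz : z ∈ tsupport φ
    · have := hsupp hz
      rw [hab z (Ioo_subset_Icc_self this.1)]
    · rw [hc z hz, mul_zero, mul_zero]
  have hφ0 : ∀ z ∉ tsupport φ, φ z = 0 := fun z hz => image_eq_zero_of_notMem_tsupport hz
  have hdφ0 : ∀ e, ∀ z ∉ tsupport φ, fderiv ℝ φ z e = 0 := fun e z hz => by
    rw [fderiv_of_notMem_tsupport ℝ hz]; rfl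
  have hdψ0 : ∀ e, ∀ z ∉ tsupport φ, fderiv ℝ ψ z e = 0 := fun e z hz => by
    rw [fderiv_of_notMem_tsupport ℝ fun h => hz (hψsupp h)]; rfl
  refine ⟨?_, ?_, ?_⟩
  · rw [hcongr hv (hdφ0 _), hcongr hvt hφ0, integral_mul_fderiv_eq_neg hw hφ1 hc]
  · rw [hcongr hv (hdφ0 _), hcongr hvx hφ0, integral_mul_fderiv_eq_neg hw hφ1 hc]
    simp only [hwx']
  -- Two integrations by parts, through the space derivative `wx`, so that no second-order
  -- regularity in time is needed.
  · rw [hcongr hv (hdψ0 _), hcongr hvxx hφ0, integral_mul_fderiv_eq_neg hw hψ1 hψc]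
    simp only [hwx', hψ]
    rw [integral_mul_fderiv_eq_neg hwx hφ1 hc, neg_neg]

theorem memLpLoc_of_continuous {p : ℝ} {u : ℝ → ℝ → ℝ} {w : ℝ × ℝ → ℝ} (hw : Continuous w)
    (hu : ∀ z : ℝ × ℝ, z.1 ∈ Icc 0 M.T → u z.1 z.2 = w z) : M.MemLpLoc p u := by
  intro R
  have hK : IsCompact (Icc 0 M.T ×ˢ Icc (-R) R : Set (ℝ × ℝ)) := isCompact_Icc.prod isCompact_Icc
  have : IsFiniteMeasure ((volume : Measure (ℝ × ℝ)).restrict (Icc 0 M.T ×ˢ Icc (-R) R)) :=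
    ⟨by rw [Measure.restrict_apply_univ]; exact hK.measure_lt_top⟩
  obtain ⟨C, hC⟩ := hK.exists_bound_of_continuousOn hw.continuousOn
  have hmem : MemLp w (ENNReal.ofReal p)
      ((volume : Measure (ℝ × ℝ)).restrict (Icc 0 M.T ×ˢ Icc (-R) R)) :=
    MemLp.of_bound hw.aestronglyMeasurable C
      (ae_restrict_of_forall_mem hK.measurableSet hC)
  refine hmem.ae_eq (ae_restrict_of_forall_mem hK.measurableSet fun z hz => ?_)
  exact (hu z hz.1).symm

end InvestmentModel

end WeakDerivatives

namespace InvestmentModel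

/-! ### The exponential ansatz -/

section Profile

variable {M : InvestmentModel} {v : ℝ → ℝ → ℝ} {G G' : ℝ → ℝ} {t x : ℝ}

/-- The growth factor `e^{r(T-t)}`. -/
noncomputable def growth (M : InvestmentModel) (t : ℝ) : ℝ := Real.exp (M.r * (M.T - t))

theorem growth_pos (t : ℝ) : 0 < M.growth t := Real.exp_pos _

theorem hasDerivAt_growth (t : ℝ) : HasDerivAt M.growth (-(M.r * M.growth t)) t := by
  have := (((hasDerivAt_id t).const_sub M.T).const_mul M.r).exp
  refine this.congr_deriv ?_
  simp [growth]; ring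

theorem contDiff_growth {n : WithTop ℕ∞} : ContDiff ℝ n M.growth := by
  unfold growth
  fun_prop

theorem continuous_growth : Continuous M.growth := (contDiff_growth (n := 0)).continuous

/-- The weight `e^{-m x e^{r(T-t)} + G(t)}`. -/
noncomputable def weight (M : InvestmentModel) (G : ℝ → ℝ) (t x : ℝ) : ℝ :=
  Real.exp (-M.m * x * M.growth t + G t)

theorem weight_pos : 0 < M.weight G t x := Real.exp_pos _

/-- `v` has the form `-(1/m) e^{-m x e^{r(T-t)} + G(t)}` on `[0, T] × ℝ`, where `G` is `C¹` with
derivative `G'`. -/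
structure IsExpProfile (M : InvestmentModel) (v : ℝ → ℝ → ℝ) (G G' : ℝ → ℝ) : Prop where
  eq : ∀ t ∈ Icc 0 M.T, ∀ x, v t x = -(1 / M.m) * M.weight G t x
  hasDerivAt : ∀ t, HasDerivAt G (G' t) t
  continuous : Continuous G'

theorem hasDerivAt_weight_space (t x : ℝ) :
    HasDerivAt (M.weight G t) (-(M.m * M.growth t * M.weight G t x)) x := by
  have := ((((hasDerivAt_id x).const_mul (-M.m)).mul_const (M.growth t)).add_const (G t)).exp
  refine this.congr_deriv ?_
  simp [weight]; ring

theorem hasDerivAt_weight_time (hG : HasDerivAt G (G' t) t) (x : ℝ) :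
    HasDerivAt (fun s => M.weight G s x)
      ((M.m * M.r * x * M.growth t + G' t) * M.weight G t x) t := by
  have := (((hasDerivAt_growth (M := M) t).const_mul (-M.m * x)).add hG).exp
  refine this.congr_deriv ?_
  simp [weight]; ring

namespace IsExpProfile

variable (hv : M.IsExpProfile v G G')
include hv

theorem contDiff : ContDiff ℝ 1 G := by
  rw [contDiff_one_iff_deriv]
  refine ⟨fun t => (hv.hasDerivAt t).differentiableAt, ?_⟩
  rw [funext fun t => (hv.hasDerivAt t).deriv]
  exact hv.continuous

theorem contDiff_weight : ContDiff ℝ 1 fun z : ℝ × ℝ => M.weight G z.1 z.2 := by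
  have h1 : ContDiff ℝ 1 fun z : ℝ × ℝ => G z.1 := hv.contDiff.comp contDiff_fst
  have h2 : ContDiff ℝ 1 fun z : ℝ × ℝ => M.growth z.1 := contDiff_growth.comp contDiff_fst
  exact (((contDiff_const.mul contDiff_snd).mul h2).add h1).exp

theorem hasDerivAt_space (hm : M.m ≠ 0) (ht : t ∈ Icc 0 M.T) (x : ℝ) :
    HasDerivAt (v t) (M.growth t * M.weight G t x) x := by
  rw [funext (hv.eq t ht)]
  refine ((hasDerivAt_weight_space t x).const_mul _).congr_deriv ?_
  field_simp

theorem dx_eq (hm : M.m ≠ 0) (ht : t ∈ Icc 0 M.T) (x : ℝ) :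
    dx v t x = M.growth t * M.weight G t x := (hv.hasDerivAt_space hm ht x).deriv

theorem hasDerivAt_deriv_space (hm : M.m ≠ 0) (ht : t ∈ Icc 0 M.T) (x : ℝ) :
    HasDerivAt (deriv (v t)) (-(M.m * M.growth t ^ 2 * M.weight G t x)) x := by
  rw [funext fun y => (hv.hasDerivAt_space hm ht y).deriv]
  refine ((hasDerivAt_weight_space t x).const_mul _).congr_deriv ?_
  ring

theorem dxx_eq (hm : M.m ≠ 0) (ht : t ∈ Icc 0 M.T) (x : ℝ) :
    dxx v t x = -(M.m * M.growth t ^ 2 * M.weight G t x) :=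
  (hv.hasDerivAt_deriv_space hm ht x).deriv

theorem hasDerivWithinAt_time (hm : M.m ≠ 0) (ht : t ∈ Icc 0 M.T) (x : ℝ) :
    HasDerivWithinAt (fun s => v s x)
      (-(M.r * x * M.growth t + G' t / M.m) * M.weight G t x) (Icc 0 M.T) t := by
  refine HasDerivWithinAt.congr (f := fun s => -(1 / M.m) * M.weight G s x) ?_
    (fun s hs => hv.eq s hs x) (hv.eq t ht x)
  refine ((hasDerivAt_weight_time (hv.hasDerivAt t) x).const_mul _).hasDerivWithinAt.congr_deriv ?_
  field_simp

theorem dt_eq (hm : M.m ≠ 0) (hT : 0 < M.T) (ht : t ∈ Icc 0 M.T) (x : ℝ) :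
    M.dt v t x = -(M.r * x * M.growth t + G' t / M.m) * M.weight G t x :=
  (hv.hasDerivWithinAt_time hm ht x).derivWithin (uniqueDiffOn_Icc hT t ht)

theorem continuousOn : ContinuousOn (Function.uncurry v) (Icc 0 M.T ×ˢ univ) :=
  (continuous_const.mul hv.contDiff_weight.continuous).continuousOn.congr
    fun z hz => hv.eq z.1 hz.1 z.2

theorem hasWeakPartials (hm : M.m ≠ 0) (hT : 0 < M.T) :
    M.HasWeakPartials v (M.dt v) (dx v) (dxx v) := by
  have hw : ContDiff ℝ 1 fun z : ℝ × ℝ => -(1 / M.m) * M.weight G z.1 z.2 :=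
    contDiff_const.mul hv.contDiff_weight
  have hwx : ContDiff ℝ 1 fun z : ℝ × ℝ => M.growth z.1 * M.weight G z.1 z.2 :=
    (contDiff_growth.comp contDiff_fst).mul hv.contDiff_weight
  have slice_time : ∀ {w : ℝ × ℝ → ℝ} {w' : ℝ} {z : ℝ × ℝ}, ContDiff ℝ 1 w →
      HasDerivAt (fun s => w (s, z.2)) w' z.1 → fderiv ℝ w z (1, 0) = w' := by
    intro w w' z hw h
    have h1 := (hw.differentiable (by norm_num) z).hasFDerivAt
    have h2 : HasDerivAt (fun s : ℝ => (s, z.2)) (1, 0) z.1 :=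
      (hasDerivAt_id z.1).prodMk (hasDerivAt_const _ _)
    exact (HasFDerivAt.comp_hasDerivAt z.1 h1 h2).unique h
  have slice_space : ∀ {w : ℝ × ℝ → ℝ} {w' : ℝ} {z : ℝ × ℝ}, ContDiff ℝ 1 w →
      HasDerivAt (fun y => w (z.1, y)) w' z.2 → fderiv ℝ w z (0, 1) = w' := by
    intro w w' z hw h
    have h1 := (hw.differentiable (by norm_num) z).hasFDerivAt
    have h2 : HasDerivAt (fun y : ℝ => (z.1, y)) (0, 1) z.2 :=
      (hasDerivAt_const _ _).prodMk (hasDerivAt_id z.2)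
    exact (HasFDerivAt.comp_hasDerivAt z.2 h1 h2).unique h
  refine hasWeakPartials_of_contDiff hw hwx (fun z hz => hv.eq _ hz _) (fun z hz => ?_)
    (fun z hz => hv.dx_eq hm hz _) (fun z => ?_) (fun z hz => ?_)
  · rw [hv.dt_eq hm hT hz]
    refine (slice_time hw (((hasDerivAt_weight_time (hv.hasDerivAt z.1) z.2).const_mul
      _).congr_deriv ?_)).symm
    field_simp
  · refine slice_space hw (((hasDerivAt_weight_space z.1 z.2).const_mul _).congr_deriv ?_)
    field_simp
  · rw [hv.dxx_eq hm hz]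
    refine (slice_space hwx (HasDerivAt.congr_deriv
      ((hasDerivAt_weight_space z.1 z.2).const_mul (M.growth z.1)) ?_)).symm
    ring

theorem hasPartials (hm : M.m ≠ 0) (hT : 0 < M.T) : M.HasPartials v where
  time _ ht x := (hv.hasDerivWithinAt_time hm ht x).differentiableWithinAt
  space _ ht x := (hv.hasDerivAt_space hm ht x).differentiableAt
  space_space _ ht x := (hv.hasDerivAt_deriv_space hm ht x).differentiableAt
  weak := hv.hasWeakPartials hm hT

/-- All the derivatives involved are given by continuous formulas, hence are bounded on compact
sets, so every `p` is allowed. -/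
theorem memW21Loc (hm : M.m ≠ 0) (hT : 0 < M.T) (p : ℝ) : M.MemW21Loc p v := by
  have hw := hv.contDiff_weight.continuous
  have hb : Continuous fun z : ℝ × ℝ => M.growth z.1 := continuous_growth.comp continuous_fst
  have hG : Continuous fun z : ℝ × ℝ => G' z.1 := hv.continuous.comp continuous_fst
  exact ⟨M.dt v, dx v, dxx v, hv.hasWeakPartials hm hT,
    memLpLoc_of_continuous (continuous_const.mul hw) fun z hz => hv.eq _ hz _,
    memLpLoc_of_continuous (w := fun z => -(M.r * z.2 * M.growth z.1 + G' z.1 / M.m) *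
      M.weight G z.1 z.2)
      (((((continuous_const.mul continuous_snd).mul hb).add (hG.div_const _)).neg).mul hw) fun z hz => hv.dt_eq hm hT hz _,
    memLpLoc_of_continuous (hb.mul hw) fun z hz => hv.dx_eq hm hz _,
    memLpLoc_of_continuous (w := fun z => -(M.m * M.growth z.1 ^ 2 * M.weight G z.1 z.2))
      ((continuous_const.mul (hb.pow 2)).mul hw).neg fun z hz => hv.dxx_eq hm hz _⟩

/-- The space derivative grows at most exponentially, uniformly in time. -/
theorem exists_dx_pow_le (hm : 0 < M.m) (hr : 0 ≤ M.r) :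
    ∃ K c, 0 ≤ K ∧ 0 ≤ c ∧ ∀ t ∈ Icc 0 M.T, ∀ x, dx v t x ^ 4 ≤ K * Real.exp (c * |x|) := by
  obtain ⟨C, hC⟩ := isCompact_Icc.exists_bound_of_continuousOn (s := Icc 0 M.T)
    hv.contDiff.continuous.continuousOn
  have hb : ∀ t ∈ Icc 0 M.T, M.growth t ≤ M.growth 0 := fun t ht =>
    Real.exp_le_exp.2 (mul_le_mul_of_nonneg_left (by linarith [ht.1]) hr)
  have h0 := growth_pos (M := M) 0
  -- The growth factor is largest at time 0, `C` bounds `G` on `[0, T]`, and the factors 4 come from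
  -- the fourth power.
  refine ⟨M.growth 0 ^ 4 * Real.exp (4 * C), 4 * (M.m * M.growth 0), by positivity, by positivity,
    fun t ht x => ?_⟩
  have hbt := growth_pos (M := M) t
  rw [hv.dx_eq hm.ne' ht, mul_pow, mul_assoc, ← Real.exp_add, weight, ← Real.exp_nat_mul]
  refine mul_le_mul (pow_le_pow_left₀ hbt.le (hb t ht) 4) (Real.exp_le_exp.2 ?_)
    (Real.exp_nonneg _) (by positivity)
  have h1 : G t ≤ C := (le_abs_self _).trans (hC t ht)
  have h2 : -M.m * x * M.growth t ≤ M.m * M.growth 0 * |x| := by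
    have e1 : -x ≤ |x| := neg_le_abs x
    have e2 := mul_le_mul_of_nonneg_left (hb t ht) hm.le
    calc -M.m * x * M.growth t = M.m * M.growth t * -x := by ring
      _ ≤ M.m * M.growth t * |x| := mul_le_mul_of_nonneg_left e1 (by positivity)
      _ ≤ _ := mul_le_mul_of_nonneg_right e2 (abs_nonneg x)
  push_cast
  linarith

end IsExpProfile

end Profile

end InvestmentModel

/-! ## The explicit value functions -/

namespace InvestmentModel

/-- The standing assumptions on the parameters. -/
structure IsStandard (M : InvestmentModel) : Prop where
  r_pos : 0 < M.r
  σ_pos : 0 < M.σ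
  δ_nonneg : 0 ≤ M.δ
  ρ_pos : 0 < M.ρ
  β_pos : 0 < M.β
  m_pos : 0 < M.m
  T_pos : 0 < M.T
  expand : M.β * M.m < M.μ / M.σ ^ 2
  cost : M.ρ ≤ M.μ ^ 2 / (2 * M.σ ^ 2 * M.m) + 1 / 2 * M.β ^ 2 * M.σ ^ 2 * M.m - M.β * M.μ

variable {M : InvestmentModel} {s t x : ℝ}

theorem growth_T : M.growth M.T = 1 := by simp [growth]

theorem freeControl_mul_growth (t : ℝ) : M.freeControl t * M.growth t = M.μ / (M.σ ^ 2 * M.m) := by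
  rw [freeControl, growth, mul_assoc, ← Real.exp_add, neg_mul, neg_add_cancel, Real.exp_zero,
    mul_one]

theorem continuous_freeControl : Continuous M.freeControl := by
  unfold freeControl
  fun_prop

theorem continuous_h : Continuous M.h := by
  unfold h
  fun_prop

/-- `e^{r(T-t)}` times the rate at which waiting beats expanding, for the truncated control. -/
noncomputable def waitingCost (M : InvestmentModel) (t : ℝ) : ℝ :=
  1 / 2 * M.σ ^ 2 * M.m * M.growth t ^ 2 * (max 0 (M.freeControl t - M.β)) ^ 2
    - M.ρ * M.growth t

theorem continuous_waitingCost : Continuous M.waitingCost := by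
  have h1 := continuous_growth (M := M)
  have h2 := continuous_freeControl (M := M)
  unfold waitingCost
  fun_prop

/-- The exponent of `V⁽¹⁾`. -/
noncomputable def exponentAfter (M : InvestmentModel) (t : ℝ) : ℝ :=
  (M.δ + M.ρ) * M.m / M.r * (M.growth t - 1) + M.g t

noncomputable def exponentAfterDeriv (M : InvestmentModel) (t : ℝ) : ℝ :=
  -((M.δ + M.ρ) * M.m * M.growth t) + M.μ ^ 2 / (2 * M.σ ^ 2)

/-- The exponent of `V`. -/
noncomputable def exponent (M : InvestmentModel) (t : ℝ) : ℝ :=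
  M.exponentAfter t + ∫ u in t..M.T, M.m * min 0 (M.waitingCost u)

noncomputable def exponentDeriv (M : InvestmentModel) (t : ℝ) : ℝ :=
  M.exponentAfterDeriv t - M.m * min 0 (M.waitingCost t)

theorem continuous_min_waitingCost : Continuous fun u => M.m * min 0 (M.waitingCost u) :=
  continuous_const.mul (continuous_const.min continuous_waitingCost)

theorem continuous_exponentAfterDeriv : Continuous M.exponentAfterDeriv := by
  have h1 := continuous_growth (M := M)
  unfold exponentAfterDeriv
  fun_prop

theorem isClosed_t1_set : IsClosed {t ∈ Icc 0 M.T | M.β ≤ M.freeControl t} :=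
  isClosed_Icc.inter (isClosed_le continuous_const continuous_freeControl)

theorem d_mul_growth (t : ℝ) :
    M.d t * M.growth t = -((M.δ + M.ρ) * M.m / M.r * (M.growth t - 1)) := by
  have : Real.exp (-M.r * (M.T - t)) * M.growth t = 1 := by
    rw [growth, ← Real.exp_add, neg_mul, neg_add_cancel, Real.exp_zero]
  rw [d]
  linear_combination ((M.δ + M.ρ) * M.m / M.r) * this

namespace IsStandard

variable (hM : M.IsStandard)
include hM

theorem μ_pos : 0 < M.μ := by
  have h1 := hM.expand
  have h2 := hM.σ_pos
  rw [lt_div_iff₀ (by positivity)] at h1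
  have := mul_pos (mul_pos hM.β_pos hM.m_pos) (pow_pos h2 2)
  linarith

theorem freeControl_pos (t : ℝ) : 0 < M.freeControl t := by
  have h1 := hM.μ_pos
  have h2 := hM.σ_pos
  have h3 := hM.m_pos
  unfold freeControl
  positivity

theorem freeControl_mono : Monotone M.freeControl := by
  intro s t hst
  have h1 := hM.μ_pos
  have h2 := hM.σ_pos
  have h3 := hM.m_pos
  unfold freeControl
  refine mul_le_mul_of_nonneg_left (Real.exp_le_exp.2 ?_) (by positivity)
  have := mul_le_mul_of_nonneg_left hst hM.r_pos.le
  nlinarith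

theorem β_le_freeControl_T : M.β ≤ M.freeControl M.T := by
  have h2 := hM.σ_pos
  have h3 := hM.m_pos
  have h1 := hM.expand
  rw [freeControl, sub_self, mul_zero, Real.exp_zero, mul_one, le_div_iff₀ (by positivity)]
  rw [lt_div_iff₀ (by positivity)] at h1
  linarith

/-- Completing the square, using that `freeControl` times `growth` is the constant μ/(σ²m). It
exhibits `h` as the loss caused by the cap β minus the opportunity cost. -/
theorem h_eq (t : ℝ) : M.h t = 1 / 2 * M.σ ^ 2 * M.m * M.growth t ^ 2 *
    (M.freeControl t - M.β) ^ 2 - M.ρ * M.growth t := by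
  have h2 := hM.σ_pos.ne'
  have h3 := hM.m_pos.ne'
  have e1 : Real.exp (2 * M.r * (M.T - t)) = M.growth t ^ 2 := by
    rw [growth, ← Real.exp_nat_mul]
    congr 1; push_cast; ring
  have e2 : M.growth t ^ 2 * (M.freeControl t - M.β) ^ 2
      = (M.μ / (M.σ ^ 2 * M.m) - M.β * M.growth t) ^ 2 := by
    rw [← freeControl_mul_growth t]; ring
  rw [mul_assoc _ (M.growth t ^ 2), e2, h, e1, ← growth]
  field_simp
  ring

/-- The defining set is closed and contains `T` by the assumption `expand`, so the infimum is
attained. The same argument with `cost` serves for `t2`. -/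
theorem t1_mem : M.t1 ∈ {t ∈ Icc 0 M.T | M.β ≤ M.freeControl t} :=
  isClosed_t1_set.csInf_mem ⟨M.T, ⟨hM.T_pos.le, le_rfl⟩, hM.β_le_freeControl_T⟩
    ⟨0, fun _ ht => ht.1.1⟩

theorem β_le_freeControl (ht : M.t1 ≤ t) : M.β ≤ M.freeControl t :=
  hM.t1_mem.2.trans (hM.freeControl_mono ht)

theorem freeControl_lt (ht0 : 0 ≤ t) (ht : t < M.t1) : M.freeControl t < M.β := by
  by_contra hcon
  exact notMem_of_lt_csInf ht ⟨0, fun _ ht => ht.1.1⟩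
    ⟨⟨ht0, ht.le.trans hM.t1_mem.1.2⟩, not_lt.1 hcon⟩

theorem h_T_nonneg : 0 ≤ M.h M.T := by
  have := hM.cost
  simp only [h, sub_self, mul_zero, Real.exp_zero, mul_one]
  linarith

theorem t2_mem : M.t2 ∈ {t ∈ Icc M.t1 M.T | 0 ≤ M.h t} :=
  (isClosed_Icc.inter (isClosed_le continuous_const continuous_h)).csInf_mem
    ⟨M.T, ⟨hM.t1_mem.1.2, le_rfl⟩, hM.h_T_nonneg⟩ ⟨M.t1, fun _ ht => ht.1.1⟩

theorem t1_le_t2 : M.t1 ≤ M.t2 := hM.t2_mem.1.1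

theorem t2_mem_Icc : M.t2 ∈ Icc 0 M.T := ⟨hM.t1_mem.1.1.trans hM.t1_le_t2, hM.t2_mem.1.2⟩

theorem h_neg (h1 : M.t1 ≤ t) (h2 : t < M.t2) : M.h t < 0 := by
  by_contra hcon
  exact notMem_of_lt_csInf h2 ⟨M.t1, fun _ ht => ht.1.1⟩
    ⟨⟨h1, h2.le.trans hM.t2_mem.1.2⟩, not_lt.1 hcon⟩

theorem growth_anti : Antitone M.growth := fun s t hst =>
  Real.exp_le_exp.2 (mul_le_mul_of_nonneg_left (by linarith) hM.r_pos.le)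

/-- Once nonnegative after `t₁`, the function `h` stays nonnegative. -/
theorem h_nonneg (ht : M.t2 ≤ t) : 0 ≤ M.h t := by
  have h2 := hM.σ_pos
  have h3 := hM.m_pos
  have hβ := hM.β_pos
  have hμ := hM.μ_pos
  have hpos := hM.t2_mem.2
  rw [hM.h_eq] at hpos ⊢
  set a := M.growth t
  set b := M.growth M.t2
  have ha : 0 < a := growth_pos t
  have hb : 0 < b := growth_pos M.t2
  have hab : a ≤ b := hM.growth_anti ht
  set q := M.μ / (M.σ ^ 2 * M.m) with hq
  have e1 : M.freeControl t * a = q := freeControl_mul_growth t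
  have e2 : M.freeControl M.t2 * b = q := freeControl_mul_growth M.t2
  have hbq : M.β * b ≤ q := by
    rw [← e2]
    exact mul_le_mul_of_nonneg_right (hM.β_le_freeControl hM.t1_le_t2) hb.le
  have f1 : a ^ 2 * (M.freeControl t - M.β) ^ 2 = (q - M.β * a) ^ 2 := by rw [← e1]; ring
  have f2 : b ^ 2 * (M.freeControl M.t2 - M.β) ^ 2 = (q - M.β * b) ^ 2 := by rw [← e2]; ring
  rw [mul_assoc _ (a ^ 2), f1]
  rw [mul_assoc _ (b ^ 2), f2] at hpos
  set c := 1 / 2 * M.σ ^ 2 * M.m with hc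
  have hc0 : 0 < c := by positivity
  have hq0 : 0 ≤ q := by positivity
  have hprod : (M.β * a) * (M.β * b) ≤ q ^ 2 := by
    have : M.β * a ≤ M.β * b := mul_le_mul_of_nonneg_left hab hβ.le
    nlinarith [mul_pos hβ ha, mul_pos hβ hb]
  -- In terms of the growth factor y this says, cross-multiplied, that (q - βy)²/y is nonincreasing
  -- while βy ≤ q. So h/y, which equals c(q - βy)²/y - ρ, cannot decrease in time after t₁.
  have hcmp : a * (q - M.β * b) ^ 2 ≤ b * (q - M.β * a) ^ 2 := by
    have : b * (q - M.β * a) ^ 2 - a * (q - M.β * b) ^ 2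
        = (b - a) * (q ^ 2 - (M.β * a) * (M.β * b)) := by ring
    have := mul_nonneg (sub_nonneg.2 hab) (sub_nonneg.2 hprod)
    linarith
  have h4 : 0 ≤ b * (c * (q - M.β * a) ^ 2 - M.ρ * a) := by
    have h5 := mul_le_mul_of_nonneg_left hcmp hc0.le
    have h6 := mul_nonneg ha.le hpos
    nlinarith
  exact nonneg_of_mul_nonneg_right h4 hb

theorem waitingCost_of_lt_t1 (h0 : 0 ≤ t) (ht : t < M.t1) :
    M.waitingCost t = -(M.ρ * M.growth t) := by
  rw [waitingCost, max_eq_left (sub_nonpos.2 (hM.freeControl_lt h0 ht).le)]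
  ring

theorem waitingCost_of_t1_le (ht : M.t1 ≤ t) : M.waitingCost t = M.h t := by
  rw [waitingCost, max_eq_right (sub_nonneg.2 (hM.β_le_freeControl ht)), hM.h_eq]

theorem waitingCost_neg (h0 : 0 ≤ t) (ht : t < M.t2) : M.waitingCost t < 0 := by
  rcases lt_or_ge t M.t1 with h1 | h1
  · rw [hM.waitingCost_of_lt_t1 h0 h1]
    exact neg_neg_of_pos (mul_pos hM.ρ_pos (growth_pos t))
  · rw [hM.waitingCost_of_t1_le h1]
    exact hM.h_neg h1 ht

theorem waitingCost_nonneg (ht : M.t2 ≤ t) : 0 ≤ M.waitingCost t := by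
  rw [hM.waitingCost_of_t1_le (hM.t1_le_t2.trans ht)]
  exact hM.h_nonneg ht

theorem hasDerivAt_exponentAfter (t : ℝ) :
    HasDerivAt M.exponentAfter (M.exponentAfterDeriv t) t := by
  have h1 := ((hasDerivAt_growth (M := M) t).sub_const 1).const_mul ((M.δ + M.ρ) * M.m / M.r)
  have h2 := ((hasDerivAt_id t).const_sub M.T).const_mul (-(M.μ ^ 2 / (2 * M.σ ^ 2)))
  refine (h1.add h2).congr_deriv ?_
  have := hM.r_pos.ne'
  simp only [exponentAfterDeriv]
  field_simp

theorem hasDerivAt_exponent (t : ℝ) : HasDerivAt M.exponent (M.exponentDeriv t) t := by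
  have hc := continuous_min_waitingCost (M := M)
  exact (hM.hasDerivAt_exponentAfter t).add (intervalIntegral.integral_hasDerivAt_left
    (hc.intervalIntegrable _ _) (hc.stronglyMeasurableAtFilter _ _) hc.continuousAt)

theorem isExpProfile_valueAfter :
    M.IsExpProfile M.valueAfter M.exponentAfter M.exponentAfterDeriv where
  eq t _ x := by
    rw [valueAfter, weight, ← growth, exponentAfter]
    congr 2
    linear_combination -(d_mul_growth t)
  hasDerivAt := hM.hasDerivAt_exponentAfter
  continuous := continuous_exponentAfterDeriv

theorem integral_after_t2 (ht : M.t2 ≤ t) (htT : t ≤ M.T) :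
    ∫ u in t..M.T, M.m * min 0 (M.waitingCost u) = 0 := by
  rw [intervalIntegral.integral_congr (g := fun _ => 0) fun u hu => ?_]
  · simp
  · rw [uIcc_of_le htT] at hu
    simp only
    rw [min_eq_left (hM.waitingCost_nonneg (ht.trans hu.1)), mul_zero]

theorem integral_between (h1 : M.t1 ≤ t) (h2 : t ≤ M.t2) :
    ∫ u in t..M.T, M.m * min 0 (M.waitingCost u) = ∫ u in t..M.t2, M.m * M.h u := by
  have hc := continuous_min_waitingCost (M := M)
  rw [← intervalIntegral.integral_add_adjacent_intervals (hc.intervalIntegrable t M.t2)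
    (hc.intervalIntegrable M.t2 M.T), hM.integral_after_t2 le_rfl hM.t2_mem_Icc.2, add_zero]
  refine intervalIntegral.integral_congr_Ioo_of_le h2 fun u hu => ?_
  have hn := hM.h_neg (h1.trans hu.1.le) hu.2
  rw [hM.waitingCost_of_t1_le (h1.trans hu.1.le), min_eq_right hn.le]

/-- Before t₁ the cap is inactive and the cost reduces to -ρ e^{r(T-t)}, which has an explicit
primitive. This term turns `d` into `d0`. -/
theorem integral_before_t1 (h0 : 0 ≤ t) (ht : t ≤ M.t1) :
    ∫ u in t..M.T, M.m * min 0 (M.waitingCost u)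
      = -(M.ρ * M.m / M.r * (M.growth t - M.growth M.t1)) + ∫ u in M.t1..M.t2, M.m * M.h u := by
  have hc := continuous_min_waitingCost (M := M)
  rw [← intervalIntegral.integral_add_adjacent_intervals (hc.intervalIntegrable t M.t1)
    (hc.intervalIntegrable M.t1 M.T), hM.integral_between le_rfl hM.t1_le_t2]
  congr 1
  have hd : ∀ u, HasDerivAt (fun u => M.ρ * M.m / M.r * M.growth u) (M.m * -(M.ρ * M.growth u)) u :=
    fun u => by
      refine ((hasDerivAt_growth (M := M) u).const_mul _).congr_deriv ?_
      have := hM.r_pos.ne'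
      field_simp
  have hcg := continuous_growth (M := M)
  rw [intervalIntegral.integral_congr_Ioo_of_le (g := fun u => M.m * -(M.ρ * M.growth u)) ht
      fun u hu => ?_,
    intervalIntegral.integral_eq_sub_of_hasDerivAt (fun u _ => hd u)
      (Continuous.intervalIntegrable (by fun_prop) _ _)]
  · ring
  · have hw := hM.waitingCost_of_lt_t1 (h0.trans hu.1.le) hu.2
    have hn := hM.waitingCost_neg (h0.trans hu.1.le) (hu.2.trans_le hM.t1_le_t2)
    simp only
    rw [min_eq_right hn.le, hw]

/-- The three branches of `value` are one exponential whose exponent is a primitive of a continuous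
function. This gives C¹ dependence on time across t₁ and t₂ without any smooth-fit computation. -/
theorem isExpProfile_value : M.IsExpProfile M.value M.exponent M.exponentDeriv where
  eq t ht x := by
    unfold value
    split_ifs with h1 h2
    · have e : Real.exp (-M.r * (M.T - t)) * M.growth t = 1 := by
        rw [growth, ← Real.exp_add, neg_mul, neg_add_cancel, Real.exp_zero]
      rw [weight, exponent, hM.integral_before_t1 ht.1 h1.le, exponentAfter, d0, g0, g, ← growth,
        ← growth]
      congr 2
      linear_combination (-((M.δ + M.ρ) * M.m / M.r - M.ρ * M.m / M.r * M.growth M.t1)) * e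
    · rw [weight, exponent, hM.integral_between (not_lt.1 h1) h2.le, exponentAfter, ← growth]
      congr 2
      linear_combination -(d_mul_growth t)
    · rw [hM.isExpProfile_valueAfter.eq t ht, weight, weight, exponent,
        hM.integral_after_t2 (not_lt.1 h2) ht.2, add_zero]
  hasDerivAt := hM.hasDerivAt_exponent
  continuous := continuous_exponentAfterDeriv.sub continuous_min_waitingCost

theorem value_eq_valueAfter (ht : M.t2 ≤ t) (x : ℝ) : M.value t x = M.valueAfter t x := by
  rw [value, if_neg (not_lt.2 (hM.t1_le_t2.trans ht)), if_neg (not_lt.2 ht)]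

/-- The exponents differ by an integral that is strictly negative before t₂, and a smaller exponent
means a larger value because of the factor -1/m. -/
theorem valueAfter_lt_value (h0 : 0 ≤ t) (ht : t < M.t2) (x : ℝ) :
    M.valueAfter t x < M.value t x := by
  have hT : t ∈ Icc 0 M.T := ⟨h0, ht.le.trans hM.t2_mem_Icc.2⟩
  have hc := continuous_min_waitingCost (M := M)
  have hneg : ∫ u in t..M.T, M.m * min 0 (M.waitingCost u) < 0 := by
    rw [← intervalIntegral.integral_add_adjacent_intervals (hc.intervalIntegrable t M.t2)
      (hc.intervalIntegrable M.t2 M.T), hM.integral_after_t2 le_rfl hM.t2_mem_Icc.2, add_zero]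
    have := intervalIntegral.intervalIntegral_pos_of_pos_on
      (f := fun u => -(M.m * min 0 (M.waitingCost u))) (hc.neg.intervalIntegrable t M.t2)
      (fun u hu => by
        have hn := hM.waitingCost_neg (h0.trans hu.1.le) hu.2
        rw [min_eq_right hn.le]
        exact neg_pos.2 (mul_neg_of_pos_of_neg hM.m_pos hn)) ht
    rw [intervalIntegral.integral_neg] at this
    linarith
  rw [hM.isExpProfile_valueAfter.eq t hT, hM.isExpProfile_value.eq t hT, neg_mul, neg_mul,
    neg_lt_neg_iff]
  have h1m : 0 < 1 / M.m := one_div_pos.2 hM.m_pos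
  refine mul_lt_mul_of_pos_left (Real.exp_lt_exp.2 ?_) h1m
  rw [exponent]
  linarith

theorem valueAfter_lt_value_iff (h0 : 0 ≤ t) (x : ℝ) :
    M.valueAfter t x < M.value t x ↔ t < M.t2 := by
  refine ⟨fun h => ?_, fun h => hM.valueAfter_lt_value h0 h x⟩
  by_contra hcon
  exact absurd (hM.value_eq_valueAfter (not_lt.1 hcon) x) h.ne'

/-- The condition does not involve `x`: the contact region is the strip [t₂, T] × ℝ. -/
theorem value_eq_valueAfter_iff (h0 : 0 ≤ t) (x : ℝ) :
    M.value t x = M.valueAfter t x ↔ M.t2 ≤ t := by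
  refine ⟨fun h => ?_, fun h => hM.value_eq_valueAfter h x⟩
  by_contra hcon
  exact absurd h (hM.valueAfter_lt_value h0 (not_le.1 hcon) x).ne'

theorem valueAfter_le_value (h0 : 0 ≤ t) (x : ℝ) : M.valueAfter t x ≤ M.value t x := by
  rcases lt_or_ge t M.t2 with h | h
  · exact (hM.valueAfter_lt_value h0 h x).le
  · exact (hM.value_eq_valueAfter h x).ge

theorem valueAfter_T (x : ℝ) : M.valueAfter M.T x = M.expUtility M.T x := by
  rw [hM.isExpProfile_valueAfter.eq M.T ⟨hM.T_pos.le, le_rfl⟩, weight, exponentAfter, growth_T,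
    expUtility, g]
  simp

theorem value_T (x : ℝ) : M.value M.T x = M.expUtility M.T x := by
  rw [hM.value_eq_valueAfter hM.t2_mem_Icc.2, hM.valueAfter_T]

/-! ### The maxima -/

/-- Completing the square in `f`: the dependence on `f` is a concave parabola with vertex
`freeControl`, so a constrained maximum is attained at the admissible control nearest to the vertex.
-/
theorem genBefore_value (ht : t ∈ Icc 0 M.T) (x f : ℝ) :
    M.genBefore M.value t x f = M.weight M.exponent t x *
      (M.growth t * (M.r * x - M.δ) + M.μ ^ 2 / (2 * M.σ ^ 2 * M.m)
        - 1 / 2 * M.σ ^ 2 * M.m * M.growth t ^ 2 * (f - M.freeControl t) ^ 2) := by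
  have h2 := hM.σ_pos.ne'
  have h3 := hM.m_pos.ne'
  have e : M.growth t ^ 2 * (f - M.freeControl t) ^ 2
      = (f * M.growth t - M.μ / (M.σ ^ 2 * M.m)) ^ 2 := by
    rw [← freeControl_mul_growth t]; ring
  rw [mul_assoc _ (M.growth t ^ 2), e, genBefore, hM.isExpProfile_value.dx_eq h3 ht,
    hM.isExpProfile_value.dxx_eq h3 ht]
  field_simp
  ring

theorem genAfter_valueAfter (ht : t ∈ Icc 0 M.T) (x f : ℝ) :
    M.genAfter M.valueAfter t x f = M.weight M.exponentAfter t x *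
      (M.growth t * (M.r * x - M.δ - M.ρ) + M.μ ^ 2 / (2 * M.σ ^ 2 * M.m)
        - 1 / 2 * M.σ ^ 2 * M.m * M.growth t ^ 2 * (f - M.freeControl t) ^ 2) := by
  have h2 := hM.σ_pos.ne'
  have h3 := hM.m_pos.ne'
  have e : M.growth t ^ 2 * (f - M.freeControl t) ^ 2
      = (f * M.growth t - M.μ / (M.σ ^ 2 * M.m)) ^ 2 := by
    rw [← freeControl_mul_growth t]; ring
  rw [mul_assoc _ (M.growth t ^ 2), e, genAfter, hM.isExpProfile_valueAfter.dx_eq h3 ht,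
    hM.isExpProfile_valueAfter.dxx_eq h3 ht]
  field_simp
  ring

theorem isGreatest_genAfter (ht : t ∈ Icc 0 M.T) (x : ℝ) :
    IsGreatest (M.genAfter M.valueAfter t x '' Ici 0)
      (M.genAfter M.valueAfter t x (M.freeControl t)) := by
  refine ⟨mem_image_of_mem _ (hM.freeControl_pos t).le, ?_⟩
  rintro _ ⟨f, -, rfl⟩
  have h3 := hM.m_pos
  rw [hM.genAfter_valueAfter ht, hM.genAfter_valueAfter ht]
  refine mul_le_mul_of_nonneg_left (sub_le_sub_left ?_ _) weight_pos.le
  rw [sub_self]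
  have : 0 ≤ 1 / 2 * M.σ ^ 2 * M.m * M.growth t ^ 2 * (f - M.freeControl t) ^ 2 := by positivity
  simpa using this

theorem dt_sub_genAfter (ht : t ∈ Icc 0 M.T) (x : ℝ) :
    -M.dt M.valueAfter t x - M.genAfter M.valueAfter t x (M.freeControl t) = 0 := by
  have h2 := hM.σ_pos.ne'
  have h3 := hM.m_pos.ne'
  rw [hM.genAfter_valueAfter ht, hM.isExpProfile_valueAfter.dt_eq h3 hM.T_pos ht,
    exponentAfterDeriv]
  field_simp
  ring

/-- The minimum is the projection of the vertex onto [0, β]; the lower end never binds because the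
vertex is positive. -/
theorem isGreatest_genBefore (ht : t ∈ Icc 0 M.T) (x : ℝ) :
    IsGreatest (M.genBefore M.value t x '' Icc 0 M.β)
      (M.genBefore M.value t x (min (M.freeControl t) M.β)) := by
  have hf := hM.freeControl_pos t
  have h3 := hM.m_pos
  refine ⟨mem_image_of_mem _ ⟨le_min hf.le hM.β_pos.le, min_le_right _ _⟩, ?_⟩
  rintro _ ⟨f, hfβ, rfl⟩
  rw [hM.genBefore_value ht, hM.genBefore_value ht]
  refine mul_le_mul_of_nonneg_left (sub_le_sub_left (mul_le_mul_of_nonneg_left ?_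
    (by positivity)) _) weight_pos.le
  rcases min_cases (M.freeControl t) M.β with ⟨h, -⟩ | ⟨h, h'⟩ <;> rw [h]
  · rw [sub_self]; nlinarith [sq_nonneg (f - M.freeControl t)]
  · nlinarith [hfβ.2]

/-- The last factor is the positive part of `waitingCost`, so one identity yields both halves of the
variational inequality: equality where the cost is negative, and the inequality everywhere. -/
theorem dt_sub_genBefore (ht : t ∈ Icc 0 M.T) (x : ℝ) :
    -M.dt M.value t x - M.genBefore M.value t x (min (M.freeControl t) M.β)
      = M.weight M.exponent t x * (M.waitingCost t - min 0 (M.waitingCost t)) := by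
  have h2 := hM.σ_pos.ne'
  have h3 := hM.m_pos.ne'
  have e : (min (M.freeControl t) M.β - M.freeControl t) ^ 2
      = (max 0 (M.freeControl t - M.β)) ^ 2 := by
    rcases le_total (M.freeControl t) M.β with h | h
    · rw [min_eq_left h, max_eq_left (sub_nonpos.2 h), sub_self]
    · rw [min_eq_right h, max_eq_right (sub_nonneg.2 h)]; ring
  have e' : M.waitingCost t = 1 / 2 * M.σ ^ 2 * M.m * M.growth t ^ 2 *
    (max 0 (M.freeControl t - M.β)) ^ 2 - M.ρ * M.growth t := rfl
  rw [hM.genBefore_value ht, hM.isExpProfile_value.dt_eq h3 hM.T_pos ht, e, exponentDeriv,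
    exponentAfterDeriv]
  generalize min 0 (M.waitingCost t) = k
  rw [e']
  field_simp
  ring

/-! ### The optimal control -/

theorem optControl_of_lt (h0 : 0 ≤ t) (ht : t < M.t2) :
    M.optControl t = min (M.freeControl t) M.β := by
  unfold optControl
  split_ifs with h1
  · rw [min_eq_left (hM.freeControl_lt h0 h1).le]
  · rw [min_eq_right (hM.β_le_freeControl (not_lt.1 h1))]

theorem optControl_of_le (ht : M.t2 ≤ t) : M.optControl t = M.freeControl t := by
  rw [optControl, if_neg (not_lt.2 (hM.t1_le_t2.trans ht)), if_neg (not_lt.2 ht)]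

/-- The optimal control as a right-continuous nondecreasing function on the line. -/
noncomputable def controlStieltjes : StieltjesFunction ℝ where
  -- A minimum replaces the branch of `optControl` at t₁. If t₁ = 0, then `optControl` can exceed β
  -- at negative times and fail to be monotone on the whole line.
  toFun s := if s < M.t2 then min (M.freeControl s) M.β else M.freeControl s
  mono' := by
    intro s t hst
    have h := hM.freeControl_mono hst
    simp only
    split_ifs with h1 h2 h2
    · exact min_le_min_right _ h
    · exact (min_le_left _ _).trans h
    · exact absurd (hst.trans_lt h2) h1
    · exact h
  right_continuous' s := by
    rcases lt_or_ge s M.t2 with h | h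
    · refine ContinuousAt.continuousWithinAt ?_
      refine ContinuousAt.congr (f := fun s => min (M.freeControl s) M.β)
        (continuous_freeControl.min continuous_const).continuousAt ?_
      filter_upwards [Iio_mem_nhds h] with u hu
      rw [if_pos (mem_Iio.1 hu)]
    · refine ContinuousWithinAt.congr (f := M.freeControl)
        continuous_freeControl.continuousWithinAt (fun u hu => ?_) ?_
      · rw [if_neg (not_lt.2 (h.trans hu))]
      · rw [if_neg (not_lt.2 h)]

theorem optControl_eq_stieltjes (h0 : 0 ≤ t) : M.optControl t = hM.controlStieltjes t := by
  change _ = if t < M.t2 then min (M.freeControl t) M.β else M.freeControl t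
  split_ifs with h
  · exact hM.optControl_of_lt h0 h
  · exact hM.optControl_of_le (not_lt.1 h)

theorem optControl_nonneg (h0 : 0 ≤ t) : 0 ≤ M.optControl t := by
  rcases lt_or_ge t M.t2 with h | h
  · rw [hM.optControl_of_lt h0 h]
    exact le_min (hM.freeControl_pos t).le hM.β_pos.le
  · rw [hM.optControl_of_le h]
    exact (hM.freeControl_pos t).le

theorem optControl_le (h0 : 0 ≤ t) : M.optControl t ≤ M.freeControl t := by
  rcases lt_or_ge t M.t2 with h | h
  · rw [hM.optControl_of_lt h0 h]
    exact min_le_left _ _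
  · rw [hM.optControl_of_le h]

theorem intervalIntegrable_optControl (ht : t ∈ Icc 0 M.T) :
    IntervalIntegrable M.optControl volume t M.T := by
  refine (hM.controlStieltjes.mono.intervalIntegrable (μ := volume)).congr fun s hs => ?_
  rw [uIoc_of_le ht.2] at hs
  exact (hM.optControl_eq_stieltjes (ht.1.trans hs.1.le)).symm

end IsStandard

theorem measurable_optControl : Measurable M.optControl := by
  have h := (continuous_freeControl (M := M)).measurable
  exact Measurable.ite measurableSet_Iio h (Measurable.ite measurableSet_Iio measurable_const h)

end InvestmentModel

/-! ## The verification hypotheses -/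

namespace InvestmentModel

namespace IsStandard

variable {Ω : Type*} {mΩ : MeasurableSpace Ω} {P : Measure Ω} {ℱ : Filtration ℝ≥0 mΩ}
  {W : ℝ≥0 → Ω → ℝ} {M : InvestmentModel} (hM : M.IsStandard) {t x : ℝ}
include hM

theorem const_mem_stoppingTimes (ℱ : Filtration ℝ≥0 mΩ) (ht : t ∈ Icc 0 M.T) :
    (fun _ : Ω => max t M.t2) ∈ M.StoppingTimes ℱ t :=
  ⟨isStoppingTime_const ℱ _, fun _ => ⟨le_max_left _ _, max_le ht.2 hM.t2_mem_Icc.2⟩⟩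

theorem solvesHJB : M.SolvesHJB M.expUtility M.valueAfter where
  equation := ae_restrict_of_forall_mem (measurableSet_Icc.prod MeasurableSet.univ) fun z hz =>
    ⟨_, hM.isGreatest_genAfter hz.1 z.2, hM.dt_sub_genAfter hz.1 z.2⟩
  terminal := hM.valueAfter_T

theorem dt_sub_genBefore_eq_zero (ht : t ∈ Icc 0 M.T) (h : t < M.t2) (x : ℝ) :
    -M.dt M.value t x - M.genBefore M.value t x (min (M.freeControl t) M.β) = 0 := by
  rw [hM.dt_sub_genBefore ht, min_eq_right (hM.waitingCost_neg ht.1 h).le, sub_self, mul_zero]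

theorem solvesVI : M.SolvesVI M.expUtility M.valueAfter M.value where
  obstacle _ ht x := hM.valueAfter_le_value ht.1 x
  equation := ae_restrict_of_forall_mem (measurableSet_Icc.prod MeasurableSet.univ) fun z hz => by
    refine ⟨_, hM.isGreatest_genBefore hz.1 z.2, fun h => ?_, fun _ => ?_⟩
    · exact hM.dt_sub_genBefore_eq_zero hz.1 ((hM.valueAfter_lt_value_iff hz.1.1 z.2).1 h) z.2
    · rw [hM.dt_sub_genBefore hz.1]
      exact mul_nonneg weight_pos.le (sub_nonneg.2 (min_le_right _ _))
  terminal := hM.value_T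

/-- The path plays no role, so the fixed-point equation for the stopping time decouples from the
state and has the same solution for every candidate time. -/
theorem setOf_contact (ht : t ∈ Icc 0 M.T) (X : ℝ → ℝ) :
    {s | s ∈ Icc t M.T ∧ M.value s (X s) = M.valueAfter s (X s)} = Icc (max t M.t2) M.T := by
  ext s
  simp only [mem_ofPred_eq, mem_Icc, max_le_iff]
  constructor
  · rintro ⟨⟨h1, h2⟩, h3⟩
    exact ⟨⟨h1, (hM.value_eq_valueAfter_iff (ht.1.trans h1) _).1 h3⟩, h2⟩
  · rintro ⟨⟨h1, h2⟩, h3⟩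
    exact ⟨⟨h1, h3⟩, hM.value_eq_valueAfter h2 _⟩

theorem isGLB_contact (ht : t ∈ Icc 0 M.T) (X : ℝ → ℝ) :
    IsGLB {s | s ∈ Icc t M.T ∧ M.value s (X s) = M.valueAfter s (X s)} (max t M.t2) := by
  rw [hM.setOf_contact ht]
  exact isGLB_Icc (max_le ht.2 hM.t2_mem_Icc.2)

variable [IsProbabilityMeasure P]

theorem isItoIntegral_optControl (hW : IsFilteredBrownian ℱ P W) (ht : t ∈ Icc 0 M.T) :
    IsItoIntegral ℱ P W t M.T (fun s _ => M.optControl s)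
      (wienerIntegral ℱ hM.controlStieltjes ht.2 W) :=
  isItoIntegral_wienerIntegral hW _ ht.2 measurable_optControl fun _ hs =>
    hM.optControl_eq_stieltjes (ht.1.trans hs.1)

theorem exists_isSurplus (hW : IsFilteredBrownian ℱ P W) (ht : t ∈ Icc 0 M.T) (x τ : ℝ) :
    ∃ X, M.IsSurplus ℱ P W t x (fun _ => τ) (fun s _ => M.optControl s) X :=
  ⟨_, isSurplus_explicitSurplus ht (hM.intervalIntegrable_optControl ht)
    (hM.isItoIntegral_optControl hW ht)⟩

theorem isSurplus_unique (hW : IsFilteredBrownian ℱ P W) (ht : t ∈ Icc 0 M.T) {τ : ℝ}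
    {X Y : ℝ → Ω → ℝ} (hX : M.IsSurplus ℱ P W t x (fun _ => τ) (fun s _ => M.optControl s) X)
    (hY : M.IsSurplus ℱ P W t x (fun _ => τ) (fun s _ => M.optControl s) Y) :
    ∀ᵐ ω ∂P, ∀ s ∈ Icc t M.T, X s ω = Y s ω := by
  have hI := hM.isItoIntegral_optControl hW ht
  filter_upwards [hX.ae_eq_linearSolution hW ht hI, hY.ae_eq_linearSolution hW ht hI]
    with ω h1 h2 s hs
  rw [h1 s hs, h2 s hs]

theorem exists_exp_bound (hW : IsFilteredBrownian ℱ P W) (ht : t ∈ Icc 0 M.T) {τ : ℝ}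
    {X : ℝ → Ω → ℝ} (hX : M.IsSurplus ℱ P W t x (fun _ => τ) (fun s _ => M.optControl s) X)
    {c : ℝ} (hc : 0 ≤ c) : ∃ Z : Ω → ℝ≥0∞, ∫⁻ ω, Z ω ∂P < ⊤ ∧
      ∀ᵐ ω ∂P, ∀ s ∈ Icc t M.T, ENNReal.ofReal (Real.exp (c * |X s ω|)) ≤ Z ω :=
  hX.exists_exp_bound hW hM.r_pos.le ht hM.controlStieltjes measurable_optControl
    (fun _ hs => hM.optControl_eq_stieltjes (ht.1.trans hs.1))
    (hM.intervalIntegrable_optControl ht) hc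

/-- The fourth power of the derivative is at most K e^{c|x|}, and the supremum of e^{c|X|} over the
time interval has an integrable bound. -/
theorem lintegral_dx_pow_lt_top (hW : IsFilteredBrownian ℱ P W) (ht : t ∈ Icc 0 M.T) {τ : ℝ}
    {X : ℝ → Ω → ℝ} (hX : M.IsSurplus ℱ P W t x (fun _ => τ) (fun s _ => M.optControl s) X)
    {v : ℝ → ℝ → ℝ} {G G' : ℝ → ℝ} (hv : M.IsExpProfile v G G') :
    ∫⁻ ω, (∫⁻ s in Icc t M.T, ENNReal.ofReal (dx v s (X s ω) ^ 4)) ∂P < ⊤ := by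
  obtain ⟨K, c, hK, hc, hKc⟩ := hv.exists_dx_pow_le hM.m_pos hM.r_pos.le
  obtain ⟨Z, hZ, hXZ⟩ := hM.exists_exp_bound hW ht hX hc
  have hle : ∀ᵐ ω ∂P, ∫⁻ s in Icc t M.T, ENNReal.ofReal (dx v s (X s ω) ^ 4)
      ≤ ENNReal.ofReal K * ENNReal.ofReal (M.T - t) * Z ω := by
    filter_upwards [hXZ] with ω hω
    refine (setLIntegral_mono' (g := fun _ => ENNReal.ofReal K * Z ω) measurableSet_Icc
      fun s hs => ?_).trans_eq ?_
    · refine (ENNReal.ofReal_le_ofReal (hKc s ⟨ht.1.trans hs.1, hs.2⟩ _)).trans ?_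
      rw [ENNReal.ofReal_mul hK]
      exact mul_le_mul_right (hω s hs) _
    · rw [setLIntegral_const, Real.volume_Icc]; ring
  refine (lintegral_mono_ae hle).trans_lt ?_
  rw [lintegral_const_mul' _ _ (ENNReal.mul_ne_top ENNReal.ofReal_ne_top ENNReal.ofReal_ne_top)]
  exact ENNReal.mul_lt_top (ENNReal.mul_lt_top ENNReal.ofReal_lt_top ENNReal.ofReal_lt_top) hZ

theorem admissible (hW : IsFilteredBrownian ℱ P W) (ht : t ∈ Icc 0 M.T) (x : ℝ) :
    M.Admissible ℱ P W M.expUtility t x (fun _ => max t M.t2) (fun s _ => M.optControl s) where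
  stopping := hM.const_mem_stoppingTimes ℱ ht
  measurable := measurable_optControl.comp measurable_fst
  adapted _ _ := measurable_const
  integrable := ae_of_all _ fun _ => by
    refine (setLIntegral_mono' (g := fun _ => ENNReal.ofReal (M.freeControl M.T ^ 4))
      measurableSet_Icc fun s hs => ENNReal.ofReal_le_ofReal ?_).trans_lt ?_
    · exact pow_le_pow_left₀ (hM.optControl_nonneg hs.1)
        ((hM.optControl_le hs.1).trans (hM.freeControl_mono hs.2)) 4
    · rw [setLIntegral_const, Real.volume_Icc]
      exact ENNReal.mul_lt_top ENNReal.ofReal_lt_top ENNReal.ofReal_lt_top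
  before _ s hs hlt := by
    have h0 : 0 ≤ s := ht.1.trans hs.1
    refine ⟨hM.optControl_nonneg h0, ?_⟩
    rw [hM.optControl_of_lt h0 ((lt_max_iff.1 hlt).resolve_left (not_lt.2 hs.1))]
    exact min_le_right _ _
  after _ _ hs _ := hM.optControl_nonneg (ht.1.trans hs.1)
  utility := by
    obtain ⟨X, hX⟩ := hM.exists_isSurplus (P := P) hW ht x (max t M.t2)
    refine ⟨X, hX, ?_⟩
    -- The negative part of the terminal utility is e^{-mX}/m, which is at most e^{m|X|}/m.
    obtain ⟨Z, hZ, hXZ⟩ := hM.exists_exp_bound hW ht hX hM.m_pos.le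
    have h1m : 0 ≤ 1 / M.m := (one_div_pos.2 hM.m_pos).le
    have hle : ∀ᵐ ω ∂P, ENNReal.ofReal (max 0 (-M.expUtility M.T (X M.T ω)))
        ≤ ENNReal.ofReal (1 / M.m) * Z ω := by
      filter_upwards [hXZ] with ω hω
      refine le_trans ?_ (mul_le_mul_right (hω M.T ⟨ht.2, le_rfl⟩) _)
      rw [← ENNReal.ofReal_mul h1m]
      refine ENNReal.ofReal_le_ofReal (max_le (mul_nonneg h1m (Real.exp_nonneg _)) ?_)
      rw [expUtility, neg_mul, neg_neg]
      refine mul_le_mul_of_nonneg_left (Real.exp_le_exp.2 ?_) h1m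
      rw [neg_mul, ← mul_neg]
      exact mul_le_mul_of_nonneg_left (neg_le_abs _) hM.m_pos.le
    refine (lintegral_mono_ae hle).trans_lt ?_
    rw [lintegral_const_mul' _ _ ENNReal.ofReal_ne_top]
    exact ENNReal.mul_lt_top ENNReal.ofReal_lt_top hZ

theorem verificationHypotheses (hW : IsFilteredBrownian ℱ P W) :
    M.VerificationHypotheses ℱ P W M.expUtility M.value M.valueAfter
      (fun t _ _ => max t M.t2) (fun s _ => M.optControl s) where
  solves_HJB := hM.solvesHJB
  solves_VI := hM.solvesVI
  -- Any exponent above 2 would do.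
  sobolev := ⟨3, by norm_num, hM.isExpProfile_value.memW21Loc hM.m_pos.ne' hM.T_pos 3,
    hM.isExpProfile_valueAfter.memW21Loc hM.m_pos.ne' hM.T_pos 3⟩
  continuous_v := hM.isExpProfile_value.continuousOn
  continuous_v1 := hM.isExpProfile_valueAfter.continuousOn
  partials_v := hM.isExpProfile_value.hasPartials hM.m_pos.ne' hM.T_pos
  partials_v1 := hM.isExpProfile_valueAfter.hasPartials hM.m_pos.ne' hM.T_pos
  dx_pos := ae_restrict_of_forall_mem (measurableSet_Icc.prod MeasurableSet.univ) fun z hz => by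
    rw [hM.isExpProfile_value.dx_eq hM.m_pos.ne' hz.1]
    exact mul_pos (growth_pos _) weight_pos
  dxx_neg := ae_restrict_of_forall_mem (measurableSet_Icc.prod MeasurableSet.univ) fun z hz => by
    rw [hM.isExpProfile_value.dxx_eq hM.m_pos.ne' hz.1]
    exact neg_neg_of_pos (mul_pos (mul_pos hM.m_pos (pow_pos (growth_pos _) 2)) weight_pos)
  state_exists _ ht x := hM.exists_isSurplus hW ht x _
  state_unique _ ht _ _ _ hX hY := hM.isSurplus_unique hW ht hX hY
  moment_v _ ht _ _ hX := hM.lintegral_dx_pow_lt_top hW ht hX hM.isExpProfile_value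
  moment_v1 _ ht _ _ hX := hM.lintegral_dx_pow_lt_top hW ht hX hM.isExpProfile_valueAfter
  contact _ ht _ := ⟨hM.const_mem_stoppingTimes ℱ ht, fun _ _ =>
    ae_of_all _ fun _ => hM.isGLB_contact ht _⟩
  contact_unique t ht _ τ' _ X _ hτ' := by
    filter_upwards [hτ'] with ω hω
    exact hω.unique (hM.isGLB_contact ht fun s => X s ω)
  admissible _ ht x _ _ := hM.admissible hW ht x
  optimal_before t ht x h := by
    have h2 := (hM.valueAfter_lt_value_iff ht.1 x).1 h
    rw [hM.optControl_of_lt ht.1 h2]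
    exact ⟨hM.isGreatest_genBefore ht x, hM.dt_sub_genBefore_eq_zero ht h2 x⟩
  optimal_after t ht x h := by
    rw [hM.optControl_of_le ((hM.value_eq_valueAfter_iff ht.1 x).1 h)]
    exact ⟨hM.isGreatest_genAfter ht x, hM.dt_sub_genAfter ht x⟩

end IsStandard

end InvestmentModel

theorem mainTheorem9 {Ω : Type*} {mΩ : MeasurableSpace Ω} (P : Measure Ω) [IsProbabilityMeasure P]
    (ℱ : Filtration ℝ≥0 mΩ) (W : ℝ≥0 → Ω → ℝ) (hW : IsFilteredBrownian ℱ P W)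
    (M : InvestmentModel) (hr : 0 < M.r) (hσ : 0 < M.σ) (hδ : 0 ≤ M.δ) (hρ : 0 < M.ρ)
    (hβ : 0 < M.β) (hm : 0 < M.m) (hT : 0 < M.T)
    (hexpand : M.β * M.m < M.μ / M.σ ^ 2)
    (hcost : M.ρ ≤ M.μ ^ 2 / (2 * M.σ ^ 2 * M.m) + 1 / 2 * M.β ^ 2 * M.σ ^ 2 * M.m - M.β * M.μ) :
    M.VerificationHypotheses ℱ P W M.expUtility M.value M.valueAfter
      (fun t _ _ => max t M.t2) (fun s _ => M.optControl s) ∧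
    ∀ t ∈ Icc 0 M.T, ∀ x : ℝ,
      M.Admissible ℱ P W M.expUtility t x (fun _ => max t M.t2) (fun s _ => M.optControl s) := by
  have hM : M.IsStandard := ⟨hr, hσ, hδ, hρ, hβ, hm, hT, hexpand, hcost⟩
  exact ⟨hM.verificationHypotheses hW, fun t ht x => hM.admissible hW ht x⟩
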